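/- **Setting.** Let $N\ge 1$, $D\ge 0$, and let $X^1,\dots,X^D$ be hermitian $N\times N$ matrices which are irreducible, i.e. only the multiples of the unit matrix commute with all $X^a$. For $x\in\mathbb R^D$ let $H_x=\frac12\sum_{a=1}^D (X^a-x^a\mathbb 1)^2$, let $\lambda(x)$ be its lowest eigenvalue and $E_x\subset\mathbb C^N$ the eigenspace of $H_x$ for $\lambda(x)$. Let $\tilde{\mathbb R}^D=\{x\in\mathbb R^D:\dim_{\mathbb C}E_x=1\}$, and let $\mathbf q:\tilde{\mathbb R}^D\to\mathbb CP^{N-1}$, $\mathbf q(x)=E_x$, be the map sending $x$ to the class of its quasi-coherent states (the unit vectors of $E_x$). The abstract quantum space is $\mathcal M=\mathbf q(\tilde{\mathbb R}^D)\subset\mathbb CP^{N-1}$ with the subspace topology. For $x,y\in\tilde{\mathbb R}^D$ write $x\sim y$ if $E_x=E_y$, and let $\mathcal N_x\subset\tilde{\mathbb R}^D$ be the equivalence class of $x$. **Theorem.** $\tilde{\mathbb R}^D$ is open in $\mathbb R^D$ and $\mathbf q$ is smooth. Suppose that the (real) rank of $d\mathbf q$ is a constant $m$ on $\tilde{\mathbb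 R}^D$. Then: 1. Every equivalence class $\mathcal N_x$ is a point, a segment of a straight line, or a piece of a higher-dimensional plane: it is a convex, relatively open subset of an affine subspace of $\mathbb R^D$ of dimension $D-m$. 2. The fibration $\mathbf q:\tilde{\mathbb R}^D\to\mathcal M\cong\tilde{\mathbb R}^D/\!\sim$ is smoothly locally trivial with typical fibre $\mathbb R^{D-m}$: every point of $\mathcal M$ has an open neighbourhood $V$ in $\mathbb CP^{N-1}$ with a diffeomorphism $\mathbf q^{-1}(V)\cong(\mathcal M\cap V)\times\mathbb R^{D-m}$ whose first component is $\mathbf q$. 3. $\mathcal M$ is an $m$-dimensional regular (embedded) real submanifold of $\mathbb CP^{N-1}$: every point of $\mathcal M$ lies in the domain of a smooth chart of $\mathbb CP^{N-1}$ (as a real manifold) which maps $\mathcal M$ onto the intersection of the chart's image with an $m$-dimensional real linear subspace. 4. $\mathcal M$ has no self-intersections: $\mathbf q(x)=\mathbf q(y)$ if and only if $y\in\mathcal N_x$, and $\mathbf q:\tilde{\mathbb R}^D\to\mathcal M$ is an open quotient map for the subspace topology of $\mathcal M$. So $\tilde{\mathbb R}^D/\!\sim\;\to\mathcal M$ is a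 homeomorphism, and the image of every neighbourhood of $x$ is a neighbourhood of $\mathbf q(x)$ in $\mathcal M$. -/

import Mathlib

open scoped LinearAlgebra.Projectivization Manifold ContDiff

noncomputable section

namespace QuantumSpace

/-! ### Complex projective space as a smooth real manifold -/

/-- The Hilbert space `ℂ^N` with `N = n + 1`. -/
abbrev Hilb (n : ℕ) : Type := EuclideanSpace ℂ (Fin (n + 1))

/-- The complex projective space `ℂP^n`: the set of complex lines in `ℂ^(n+1)`. -/
abbrev CP (n : ℕ) : Type := ℙ ℂ (Hilb n)

/-- The model space `ℂ^n` of `ℂP^n`. -/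
abbrev CPModel (n : ℕ) : Type := EuclideanSpace ℂ (Fin n)

/-- `ℂP^n` carries the quotient topology from `ℂ^(n+1) ∖ {0}`. -/
instance instTopologicalSpaceCP (n : ℕ) : TopologicalSpace (CP n) :=
  inferInstanceAs (TopologicalSpace (Quotient (projectivizationSetoid ℂ (Hilb n))))

theorem isQuotientMap_mk' (n : ℕ) :
    Topology.IsQuotientMap (Projectivization.mk' ℂ : {v : Hilb n // v ≠ 0} → CP n) :=
  isQuotientMap_quot_mk

/-- The domain `{[z] : z_i ≠ 0}` of the `i`-th affine chart. -/
def affineSource (n : ℕ) (i : Fin (n + 1)) : Set (CP n) :=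
  {p | Projectivization.lift (fun v : {v : Hilb n // v ≠ 0} => v.1 i ≠ 0) (by
    rintro ⟨a, ha⟩ ⟨b, hb⟩ t h
    have h' : a = t • b := h
    subst h'
    have ht : t ≠ 0 := by rintro rfl; simp at ha
    simp [ht]) p}

/-- The `i`-th affine coordinates `[z] ↦ (z_j / z_i)_{j ≠ i}`. -/
def affineCoord (n : ℕ) (i : Fin (n + 1)) : CP n → CPModel n :=
  Projectivization.lift
    (fun v : {v : Hilb n // v ≠ 0} => WithLp.toLp 2 fun j : Fin n => v.1 (i.succAbove j) / v.1 i)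
    (by
      rintro ⟨a, ha⟩ ⟨b, hb⟩ t h
      have h' : a = t • b := h
      subst h'
      have ht : t ≠ 0 := by rintro rfl; simp at ha
      ext j
      simp [mul_div_mul_left _ _ ht])

/-- The vector with `i`-th entry `1` and remaining entries `w`. -/
def affineVec (n : ℕ) (i : Fin (n + 1)) (w : CPModel n) : Hilb n :=
  WithLp.toLp 2 (i.insertNth (α := fun _ => ℂ) 1 w.ofLp)

theorem affineVec_self (n : ℕ) (i : Fin (n + 1)) (w : CPModel n) : affineVec n i w i = 1 := by
  simp [affineVec]

theorem affineVec_succAbove (n : ℕ) (i : Fin (n + 1)) (w : CPModel n) (j : Fin n) :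
    affineVec n i w (i.succAbove j) = w j := by
  simp [affineVec]

theorem affineVec_ne_zero (n : ℕ) (i : Fin (n + 1)) (w : CPModel n) : affineVec n i w ≠ 0 := by
  intro h
  have := affineVec_self n i w
  rw [h] at this
  simp at this

theorem contDiff_affineVec (n : ℕ) (i : Fin (n + 1)) : ContDiff ℝ ∞ (affineVec n i) := by
  refine contDiff_piLp' 2 fun k => ?_
  rcases Fin.eq_self_or_eq_succAbove i k with rfl | ⟨j, rfl⟩
  · simp only [affineVec_self]
    exact contDiff_const
  · simp only [affineVec_succAbove]
    exact contDiff_piLp_apply 2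

/-- The `i`-th affine chart of `ℂP^n`. -/
def affineChart (n : ℕ) (i : Fin (n + 1)) : OpenPartialHomeomorph (CP n) (CPModel n) where
  toFun := affineCoord n i
  invFun w := Projectivization.mk ℂ (affineVec n i w) (affineVec_ne_zero n i w)
  source := affineSource n i
  target := Set.univ
  map_source' _ _ := Set.mem_univ _
  map_target' w _ := by
    change affineVec n i w i ≠ 0
    rw [affineVec_self]
    exact one_ne_zero
  left_inv' p hp := by
    induction p using Projectivization.ind with
    | h v hv =>
      change v i ≠ 0 at hp
      rw [Projectivization.mk_eq_mk_iff']
      refine ⟨(v i)⁻¹, ?_⟩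
      ext k
      rcases Fin.eq_self_or_eq_succAbove i k with rfl | ⟨j, rfl⟩
      · rw [affineVec_self]
        simp [hp]
      · rw [affineVec_succAbove]
        simp [affineCoord, div_eq_inv_mul]
  right_inv' w _ := by
    ext j
    simp [affineCoord, affineVec_self, affineVec_succAbove]
  open_source := by
    rw [← (isQuotientMap_mk' n).isOpen_preimage]
    change IsOpen {v : {v : Hilb n // v ≠ 0} | v.1 i ≠ 0}
    exact isOpen_ne_fun (by fun_prop) continuous_const
  open_target := isOpen_univ
  continuousOn_toFun := by
    have ho : IsOpen (affineSource n i) := by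
      rw [← (isQuotientMap_mk' n).isOpen_preimage]
      change IsOpen {v : {v : Hilb n // v ≠ 0} | v.1 i ≠ 0}
      exact isOpen_ne_fun (by fun_prop) continuous_const
    rw [(isQuotientMap_mk' n).continuousOn_isOpen_iff ho]
    change ContinuousOn (fun v : {v : Hilb n // v ≠ 0} =>
      (WithLp.toLp 2 fun j : Fin n => v.1 (i.succAbove j) / v.1 i : CPModel n))
      {v : {v : Hilb n // v ≠ 0} | v.1 i ≠ 0}
    refine (PiLp.continuous_toLp 2 _).comp_continuousOn (continuousOn_pi.2 fun j => ?_)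
    exact ContinuousOn.div (by fun_prop) (by fun_prop) fun v hv => hv
  continuousOn_invFun := by
    refine Continuous.continuousOn ?_
    exact (isQuotientMap_mk' n).continuous.comp
      ((contDiff_affineVec n i).continuous.subtype_mk (affineVec_ne_zero n i))

theorem exists_mem_affineSource (n : ℕ) (p : CP n) : ∃ i, p ∈ affineSource n i := by
  induction p using Projectivization.ind with
  | h v hv =>
    by_contra! h
    refine hv ?_
    ext i
    have := h i
    change ¬ (v i ≠ 0) at this
    simpa using this

/-- The atlas of affine charts on `ℂP^n`. -/
instance instChartedSpaceCP (n : ℕ) : ChartedSpace (CPModel n) (CP n) where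
  atlas := Set.range (affineChart n)
  chartAt p := affineChart n (exists_mem_affineSource n p).choose
  mem_chart_source p := (exists_mem_affineSource n p).choose_spec
  chart_mem_atlas _ := Set.mem_range_self _

/-- `ℂP^n` is a smooth real manifold (of real dimension `2 n`). -/
instance instIsManifoldCP (n : ℕ) : IsManifold 𝓘(ℝ, CPModel n) ∞ (CP n) := by
  refine isManifold_of_contDiffOn _ _ _ ?_
  rintro _ _ ⟨i, rfl⟩ ⟨k, rfl⟩
  have h1 : ContDiffOn ℝ ∞ (fun w : CPModel n =>
      (WithLp.toLp 2 fun j : Fin n => affineVec n i w (k.succAbove j) / affineVec n i w k :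
        CPModel n)) {w | affineVec n i w k ≠ 0} := by
    have hc : ∀ l, ContDiff ℝ ∞ fun w : CPModel n => affineVec n i w l := fun l =>
      (contDiff_piLp_apply (𝕜 := ℝ) (E := fun _ : Fin (n + 1) => ℂ) 2).comp
        (contDiff_affineVec n i)
    refine contDiffOn_piLp' 2 fun j => ?_
    simp only [div_eq_mul_inv]
    exact (hc _).contDiffOn.mul ((hc _).contDiffOn.inv fun w hw => hw)
  refine h1.mono ?_
  intro w hw
  exact hw.1.2

/-! ### Regular submanifolds and locally trivial fibrations -/

/-- `S ⊆ ℂP^n` is a regular (that is, embedded) real submanifold of dimension `m`: around each of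
its points there is a smooth chart of `ℂP^n` in which `S` is an `m`-dimensional real linear
slice. -/
def IsRegularSubmanifold {n : ℕ} (m : ℕ) (S : Set (CP n)) : Prop :=
  ∀ p ∈ S, ∃ e ∈ IsManifold.maximalAtlas 𝓘(ℝ, CPModel n) ∞ (CP n), p ∈ e.source ∧
    ∃ F : Submodule ℝ (CPModel n), Module.finrank ℝ F = m ∧
      e '' (e.source ∩ S) = e.target ∩ (F : Set (CPModel n))

/-- The map `q`, defined on `R ⊆ ℝ^D`, is a smoothly locally trivial fibration with typical fibre
`ℝ^k` over its image: over a neighbourhood of each point of `q(R)` there is a trivialization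
`x ↦ (q x, τ x)`, smooth and with smooth inverse `σ`. -/
def IsLocallyTrivialFibration {D n : ℕ} (k : ℕ) (R : Set (EuclideanSpace ℝ (Fin D)))
    (q : EuclideanSpace ℝ (Fin D) → CP n) : Prop :=
  ∀ p ∈ q '' R, ∃ V : Set (CP n), IsOpen V ∧ p ∈ V ∧
    ∃ (τ : EuclideanSpace ℝ (Fin D) → EuclideanSpace ℝ (Fin k))
      (σ : CP n × EuclideanSpace ℝ (Fin k) → EuclideanSpace ℝ (Fin D)),
      ContDiffOn ℝ ∞ τ (R ∩ q ⁻¹' V) ∧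
      ContMDiffOn (𝓘(ℝ, CPModel n).prod 𝓘(ℝ, EuclideanSpace ℝ (Fin k)))
        𝓘(ℝ, EuclideanSpace ℝ (Fin D)) ∞ σ ((q '' R ∩ V) ×ˢ Set.univ) ∧
      (∀ x ∈ R ∩ q ⁻¹' V, σ (q x, τ x) = x) ∧
      ∀ y ∈ q '' R ∩ V, ∀ t, σ (y, t) ∈ R ∧ q (σ (y, t)) = y ∧ τ (σ (y, t)) = t

/-! ### Matrix configurations and quasi-coherent states -/

/-- A matrix configuration is irreducible if only the multiples of the unit matrix commute with
all its matrices. -/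
def IsIrreducible {D n : ℕ} (X : Fin D → Matrix (Fin (n + 1)) (Fin (n + 1)) ℂ) : Prop :=
  ∀ B : Matrix (Fin (n + 1)) (Fin (n + 1)) ℂ, (∀ a, Commute B (X a)) → ∃ c : ℂ, B = c • 1

variable {D n : ℕ} (X : Fin D → Matrix (Fin (n + 1)) (Fin (n + 1)) ℂ)

/-- The displacement Hamiltonian `H_x = ½ ∑_a (X^a - x^a)²`. -/
def displacementHamiltonian (x : EuclideanSpace ℝ (Fin D)) :
    Matrix (Fin (n + 1)) (Fin (n + 1)) ℂ :=
  (1 / 2 : ℂ) • ∑ a, (X a - (x a : ℂ) • 1) ^ 2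

/-- The lowest eigenvalue `λ(x)` of `H_x`. (For hermitian `X^a`, the set of eigenvalues is a
nonempty finite set of reals.) -/
def lowestEigenvalue (x : EuclideanSpace ℝ (Fin D)) : ℝ :=
  sInf {μ : ℝ | Module.End.HasEigenvalue
    (Matrix.toEuclideanLin (displacementHamiltonian X x)) (μ : ℂ)}

/-- The eigenspace `E_x` of `H_x` for the lowest eigenvalue `λ(x)`; its unit vectors are the
quasi-coherent states at `x`. -/
def groundSpace (x : EuclideanSpace ℝ (Fin D)) : Submodule ℂ (Hilb n) :=
  Module.End.eigenspace (Matrix.toEuclideanLin (displacementHamiltonian X x))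
    (lowestEigenvalue X x : ℂ)

/-- `R̃^D = ℝ^D ∖ K`: the points `x` for which `E_x` is one-dimensional. -/
def regularDomain : Set (EuclideanSpace ℝ (Fin D)) :=
  {x | Module.finrank ℂ (groundSpace X x) = 1}

open Classical in
/-- The map `q : R̃^D → ℂP^n`, sending `x` to the line `E_x` of its quasi-coherent states (with an
irrelevant value outside `R̃^D`). -/
def quantumMap (x : EuclideanSpace ℝ (Fin D)) : CP n :=
  if h : Module.finrank ℂ (groundSpace X x) = 1 then Projectivization.mk'' (groundSpace X x) h
  else Classical.arbitrary _

/-- The abstract quantum space `M ⊆ ℂP^n`, the image of `q`. -/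
def abstractQuantumSpace : Set (CP n) := quantumMap X '' regularDomain X

/-- The equivalence class `N_x` of `x`: the points of `R̃^D` with the same quasi-coherent
states. -/
def equivClass (x : EuclideanSpace ℝ (Fin D)) : Set (EuclideanSpace ℝ (Fin D)) :=
  {y ∈ regularDomain X | groundSpace X y = groundSpace X x}

/-- The rank of the differential `dq` at a point `x` of `R̃^D`. -/
def rankDq (x : EuclideanSpace ℝ (Fin D)) : ℕ :=
  Module.finrank ℝ (LinearMap.range
    (mfderivWithin 𝓘(ℝ, EuclideanSpace ℝ (Fin D)) 𝓘(ℝ, CPModel n) (quantumMap X)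
      (regularDomain X) x).toLinearMap)

end QuantumSpace

end

/-! Expanding the square gives `H_x = H_0 - ∑ x^a X^a + |x|²/2`. The last term is a scalar, so `E_x`
is the lowest eigenspace of `K_x = H_0 - ∑ x^a X^a`, which is affine in `x`. By `simple_ground_iff`,
a vector `v ≠ 0` spans a simple lowest eigenspace iff `K_x v = c v` and `K_x - c + |v⟩⟨v|` is
positive definite for some real `c`. In an affine chart `v` is normalized by `v_i = 1`, so `c` is
the `i`-th entry of `K_x v`. For fixed `v` the first condition is then a linear system in `x`, and
the second is an open convex condition. Hence each `N_x` is convex and relatively open in an affine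
subspace.

The implicit function theorem applies to the eigenvector equation, because simplicity of the
eigenvalue makes its derivative in the state invertible (`residue_derivative_injective`). It gives
the smoothness of `q` and identifies `ker dq` with the kernel of the linear system
(`fderiv_solution_eq_zero_iff`), so the affine subspaces have dimension `D - m`.

If the rank is constant, the systems belonging to points of `M` have kernels of one dimension. Their
solutions can therefore be parametrized smoothly by a family defined for all nearby states, on `M`
or not (`exists_affine_parametrization`). Freezing the parameter gives a local section `s`. Sections
with values near a prescribed point make `q` open, and `q ∘ s` is a smooth retraction of an open set
onto `M`, so `M` is a submanifold (`exists_slice_of_retraction`).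

For local triviality, the fibres are open convex sets `{y | Γ(w, y) > 0}` with `Γ` affine in `y`.
The trace of `Γ⁻¹` is a barrier function, and the radial stretching `y ↦ (1 + tr Γ(w, y)⁻¹) y` maps
each fibre diffeomorphically onto the whole space, smoothly in `w` (`exists_fibrewise_diffeo`). -/

noncomputable section
namespace QuantumSpace

open scoped InnerProductSpace

/-! ### Operators with positive definite hermitian form -/

/-- The operators on `ℂ^(n+1)`. -/
abbrev Op (n : ℕ) : Type := Hilb n →L[ℂ] Hilb n

/-- The real part of the form `⟪u, G u⟫` is positive definite. -/
def PosForm {n : ℕ} (G : Op n) : Prop := ∀ u, u ≠ 0 → 0 < (⟪u, G u⟫_ℂ).re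

/-- The trace of the inverse of an operator. -/
def traceInv {n : ℕ} (G : Op n) : ℝ :=
  ∑ k, (⟪EuclideanSpace.single k (1 : ℂ), Ring.inverse G (EuclideanSpace.single k (1 : ℂ))⟫_ℂ).re

section PositiveForms

variable {n : ℕ}

theorem PosForm.exists_lower_bound {G : Op n} (hG : PosForm G) :
    ∃ ε > 0, ∀ u, ε * ‖u‖ ^ 2 ≤ (⟪u, G u⟫_ℂ).re := by
  have hc : Continuous fun u : Hilb n => (⟪u, G u⟫_ℂ).re :=
    Complex.continuous_re.comp (continuous_id.inner G.continuous)
  obtain ⟨v, hv, hmin⟩ := (isCompact_sphere (0 : Hilb n) 1).exists_isMinOn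
    ⟨EuclideanSpace.single 0 1, by simp⟩ hc.continuousOn
  have hv0 : v ≠ 0 := by rintro rfl; simp at hv
  refine ⟨_, hG v hv0, fun u => ?_⟩
  by_cases hu : u = 0
  · simp [hu]
  have hu' : ‖u‖ ≠ 0 := norm_ne_zero_iff.2 hu
  have h1 := hmin (show ((‖u‖⁻¹ : ℝ) : ℂ) • u ∈ Metric.sphere (0 : Hilb n) 1 by
    simp [norm_smul, hu'])
  simp only [Set.mem_ofPred_eq, map_smul, inner_smul_left, inner_smul_right, Complex.conj_ofReal,
    Complex.re_ofReal_mul] at h1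
  calc _ ≤ (‖u‖⁻¹ * (‖u‖⁻¹ * (⟪u, G u⟫_ℂ).re)) * ‖u‖ ^ 2 := by gcongr
    _ = _ := by field_simp

/-- The form is at least `ε` on the compact unit sphere, and a perturbation of norm less than `ε`
cannot spoil its sign. -/
theorem isOpen_posForm : IsOpen {G : Op n | PosForm G} := by
  rw [Metric.isOpen_iff]
  intro G hG
  obtain ⟨ε, hε, h⟩ := PosForm.exists_lower_bound hG
  refine ⟨ε, hε, fun G' hG' u hu => ?_⟩
  rw [Metric.mem_ball, dist_eq_norm] at hG'
  have h1 : |(⟪u, (G' - G) u⟫_ℂ).re| ≤ ‖u‖ * (‖G' - G‖ * ‖u‖) :=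
    (Complex.abs_re_le_norm _).trans ((norm_inner_le_norm _ _).trans
      (by gcongr; exact (G' - G).le_opNorm u))
  have h2 : (⟪u, G' u⟫_ℂ).re = (⟪u, G u⟫_ℂ).re + (⟪u, (G' - G) u⟫_ℂ).re := by
    simp
  have h3 := h u
  have hu' : 0 < ‖u‖ := norm_pos_iff.2 hu
  have h4 : ‖u‖ * (‖G' - G‖ * ‖u‖) < ε * ‖u‖ ^ 2 := by
    have : 0 < ‖u‖ ^ 2 := by positivity
    nlinarith
  have := neg_abs_le (⟪u, (G' - G) u⟫_ℂ).re
  linarith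

theorem PosForm.isUnit {G : Op n} (hG : PosForm G) : IsUnit G := by
  have hinj : Function.Injective G := by
    rw [injective_iff_map_eq_zero]
    intro u hu
    by_contra h
    simpa [hu] using hG u h
  have hu : IsUnit (G : Hilb n →ₗ[ℂ] Hilb n) :=
    (LinearMap.isUnit_iff_ker_eq_bot _).2 (LinearMap.ker_eq_bot.2 hinj)
  rw [ContinuousLinearMap.isUnit_iff_bijective]
  exact (Module.End.isUnit_iff _).1 hu

theorem PosForm.apply_inverse {G : Op n} (hG : PosForm G) (u : Hilb n) :
    G (Ring.inverse G u) = u :=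
  DFunLike.congr_fun (Ring.mul_inverse_cancel G hG.isUnit) u

/-- The variational lower bound for the form of the inverse. -/
theorem PosForm.le_inverse {G : Op n} (hG : PosForm G)
    (hs : (G : Hilb n →ₗ[ℂ] Hilb n).IsSymmetric) (u z : Hilb n) :
    2 * (⟪z, u⟫_ℂ).re - (⟪z, G z⟫_ℂ).re ≤ (⟪u, Ring.inverse G u⟫_ℂ).re := by
  set q := Ring.inverse G u with hq
  have hGq : G q = u := hG.apply_inverse u
  -- Completing the square: the bound is the nonnegativity of the form at `q - z`, with equality at
  -- `z = G⁻¹ u`.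
  have h0 : 0 ≤ (⟪q - z, G (q - z)⟫_ℂ).re := by
    by_cases h : q - z = 0
    · simp [h]
    · exact (hG _ h).le
  have h1 : ⟪q, G z⟫_ℂ = ⟪u, z⟫_ℂ := by rw [← hGq]; exact (hs q z).symm
  have h2 : (⟪u, z⟫_ℂ).re = (⟪z, u⟫_ℂ).re := inner_re_symm (𝕜 := ℂ) u z
  have h3 : (⟪u, q⟫_ℂ).re = (⟪q, u⟫_ℂ).re := inner_re_symm (𝕜 := ℂ) u q
  simp only [map_sub, inner_sub_left, inner_sub_right, Complex.sub_re, h1, hGq] at h0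
  linarith

theorem PosForm.inverse_nonneg {G : Op n} (hG : PosForm G)
    (hs : (G : Hilb n →ₗ[ℂ] Hilb n).IsSymmetric) (u : Hilb n) :
    0 ≤ (⟪u, Ring.inverse G u⟫_ℂ).re := by
  simpa using hG.le_inverse hs u 0

theorem PosForm.traceInv_nonneg {G : Op n} (hG : PosForm G)
    (hs : (G : Hilb n →ₗ[ℂ] Hilb n).IsSymmetric) : 0 ≤ traceInv G :=
  Finset.sum_nonneg fun _ _ => hG.inverse_nonneg hs _

/-- A bound on the trace of the inverse bounds the operator from below. -/
theorem PosForm.lower_bound_of_traceInv_le {G : Op n} (hG : PosForm G)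
    (hs : (G : Hilb n →ₗ[ℂ] Hilb n).IsSymmetric) {C : ℝ} (hC : traceInv G ≤ C) (z : Hilb n) :
    ‖z‖ ^ 2 ≤ C * (⟪z, G z⟫_ℂ).re := by
  by_cases hz : z = 0
  · simp [hz]
  set g := (⟪z, G z⟫_ℂ).re
  have hz' : 0 < ‖z‖ ^ 2 := by positivity
  -- Test `le_inverse` at the `k`-th basis vector with `s * conj (z k) * z`; summing over `k` turns
  -- `∑ |z k|²` into `‖z‖²`.
  have key : ∀ s : ℝ, 2 * s * ‖z‖ ^ 2 - s ^ 2 * ‖z‖ ^ 2 * g ≤ C := by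
    intro s
    refine le_trans ?_ hC
    rw [EuclideanSpace.norm_sq_eq, Finset.mul_sum, Finset.mul_sum, Finset.sum_mul,
      ← Finset.sum_sub_distrib]
    refine Finset.sum_le_sum fun k _ => le_trans (le_of_eq ?_)
      (hG.le_inverse hs _ ((s : ℂ) • (starRingEnd ℂ (z k)) • z))
    have e1 : ⟪(s : ℂ) • (starRingEnd ℂ (z k)) • z, EuclideanSpace.single k (1 : ℂ)⟫_ℂ
        = ((s * ‖z k‖ ^ 2 : ℝ) : ℂ) := by
      simp only [inner_smul_left, EuclideanSpace.inner_single_right, Complex.conj_ofReal,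
        Complex.conj_conj, one_mul, Complex.ofReal_mul, Complex.ofReal_pow]
      rw [← Complex.mul_conj']
    have e2 : (⟪(s : ℂ) • (starRingEnd ℂ (z k)) • z, G ((s : ℂ) • (starRingEnd ℂ (z k)) • z)⟫_ℂ)
        = ((s ^ 2 * ‖z k‖ ^ 2 : ℝ) : ℂ) * ⟪z, G z⟫_ℂ := by
      simp only [map_smul, inner_smul_left, inner_smul_right, Complex.conj_ofReal,
        Complex.conj_conj, Complex.ofReal_mul, Complex.ofReal_pow]
      rw [← Complex.mul_conj']
      ring
    rw [e1, e2, Complex.re_ofReal_mul, Complex.ofReal_re]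
    ring
  have h0 := key 0
  -- This `s` yields `C ≤ C² g / ‖z‖²`. The factor `C` cancels because it is positive: `C = 0` is
  -- refuted by `s = 1 / g`.
  have h := key (C / ‖z‖ ^ 2)
  have e : 2 * (C / ‖z‖ ^ 2) * ‖z‖ ^ 2 - (C / ‖z‖ ^ 2) ^ 2 * ‖z‖ ^ 2 * g
      = 2 * C - C * (C * g) / ‖z‖ ^ 2 := by field_simp
  rw [e] at h
  have hCpos : 0 < C := by
    by_contra hneg
    have h1 := key 1
    have hC0 : C = 0 := by linarith
    have hgpos : 0 < g := hG z hz
    have h2 := key (1 / g)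
    have : 2 * (1 / g) * ‖z‖ ^ 2 - (1 / g) ^ 2 * ‖z‖ ^ 2 * g = ‖z‖ ^ 2 / g := by
      field_simp; ring
    rw [this, hC0] at h2
    have : 0 < ‖z‖ ^ 2 / g := by positivity
    linarith
  have h5 : C ≤ C * (C * g) / ‖z‖ ^ 2 := by linarith
  rw [le_div_iff₀ hz'] at h5
  exact le_of_mul_le_mul_left h5 hCpos

theorem contDiffAt_traceInv {G : Op n} (hG : PosForm G) : ContDiffAt ℝ ∞ (traceInv (n := n)) G := by
  have h1 : ContDiffAt ℝ ∞ (Ring.inverse : Op n → Op n) G := by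
    obtain ⟨u, rfl⟩ := hG.isUnit
    exact (contDiffAt_ringInverse ℂ u).restrict_scalars ℝ
  unfold traceInv
  refine ContDiffAt.sum fun k _ => ?_
  have h2 : ∀ v : Hilb n, ContDiff ℝ ∞ fun A : Op n => A v := fun v =>
    ((ContinuousLinearMap.apply ℂ (Hilb n) v).restrictScalars ℝ).contDiff
  have h3 : ∀ v : Hilb n, ContDiff ℝ ∞ fun u : Hilb n => (⟪v, u⟫_ℂ).re := fun v =>
    (Complex.reCLM.comp ((innerSL ℂ v).restrictScalars ℝ)).contDiff
  exact ((h3 _).comp (h2 _)).contDiffAt.comp G h1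

end PositiveForms

/-! ### The smooth inverse function theorem on open sets -/

section InverseFunction

variable {E F : Type*} [NormedAddCommGroup E] [NormedSpace ℝ E] [NormedAddCommGroup F]
  [NormedSpace ℝ F] [CompleteSpace E]

/-- The source is cut down to the open set where the derivative is invertible, so that the inverse
is smooth on the whole target and not only at the image of `a`. -/
theorem exists_smooth_openPartialHomeomorph {f : E → F} {O : Set E} (hO : IsOpen O)
    (hf : ContDiffOn ℝ ∞ f O) {a : E} (ha : a ∈ O) {e' : E ≃L[ℝ] F}
    (he' : HasFDerivAt f (e' : E →L[ℝ] F) a) :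
    ∃ e : OpenPartialHomeomorph E F, ⇑e = f ∧ a ∈ e.source ∧ e.source ⊆ O ∧
      ContDiffOn ℝ ∞ e.symm e.target := by
  have hfa : ContDiffAt ℝ ∞ f a := hf.contDiffAt (hO.mem_nhds ha)
  set e₀ := hfa.toOpenPartialHomeomorph f he' (by simp) with he₀
  have hcoe : ⇑e₀ = f := rfl
  set s := O ∩ fderiv ℝ f ⁻¹' Set.range ((↑) : (E ≃L[ℝ] F) → E →L[ℝ] F)
  have hs : IsOpen s := (hf.continuousOn_fderiv_of_isOpen hO (by simp)).isOpen_inter_preimage hO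
    ContinuousLinearEquiv.isOpen
  have has : a ∈ s := ⟨ha, e', he'.fderiv.symm⟩
  refine ⟨e₀.restrOpen s hs, rfl, ⟨hfa.mem_toOpenPartialHomeomorph_source he' (by simp), has⟩,
    fun x hx => hx.2.1, fun y hy => ?_⟩
  have hx : (e₀.restrOpen s hs).symm y ∈ (e₀.restrOpen s hs).source :=
    (e₀.restrOpen s hs).map_target hy
  obtain ⟨e₁, he₁⟩ := hx.2.2
  have hc : ContDiffAt ℝ ∞ f ((e₀.restrOpen s hs).symm y) := hf.contDiffAt (hO.mem_nhds hx.2.1)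
  refine ((e₀.restrOpen s hs).contDiffAt_symm (f₀' := e₁) hy ?_ hc).contDiffWithinAt
  rw [he₁]
  exact (hc.differentiableAt (by simp)).hasFDerivAt

theorem exists_smooth_inverse [Nonempty E] {f : E → F} {O : Set E} (hO : IsOpen O)
    (hf : ContDiffOn ℝ ∞ f O) (hinj : Set.InjOn f O)
    (hder : ∀ a ∈ O, ∃ e' : E ≃L[ℝ] F, HasFDerivAt f (e' : E →L[ℝ] F) a) :
    ∃ g : F → E, ContDiffOn ℝ ∞ g (f '' O) ∧ ∀ a ∈ O, g (f a) = a := by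
  have hg : ∀ a ∈ O, Function.invFunOn f O (f a) = a := hinj.leftInvOn_invFunOn
  refine ⟨Function.invFunOn f O, ?_, hg⟩
  rintro _ ⟨a, ha, rfl⟩
  obtain ⟨e', he'⟩ := hder a ha
  obtain ⟨e, hef, hae, heO, hsm⟩ := exists_smooth_openPartialHomeomorph hO hf ha he'
  have hmem : e.target ∈ nhds (f a) := e.open_target.mem_nhds (hef ▸ e.map_source hae)
  refine ((hsm.contDiffAt hmem).congr_of_eventuallyEq ?_).contDiffWithinAt
  filter_upwards [hmem] with b hb
  have h1 : f (e.symm b) = b := by rw [← hef]; exact e.right_inv hb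
  conv_lhs => rw [← h1]
  exact hg _ (heO (e.map_target hb))

theorem exists_equiv_of_injective {V : Type*} [NormedAddCommGroup V] [NormedSpace ℝ V]
    [FiniteDimensional ℝ V] (L : V →L[ℝ] V) (h : ∀ v, L v = 0 → v = 0) :
    ∃ e : V ≃L[ℝ] V, (e : V →L[ℝ] V) = L := by
  have hinj : Function.Injective (L : V →ₗ[ℝ] V) := (injective_iff_map_eq_zero _).2 h
  refine ⟨(LinearEquiv.ofInjectiveEndo (L : V →ₗ[ℝ] V) hinj).toContinuousLinearEquiv, ?_⟩
  ext v
  rfl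

end InverseFunction

/-! ### Trivializing families of spectrahedra -/

section Ray

variable {n : ℕ}

/-- Positive definite forms are a convex set; hence the positive part of a ray starting at `B` is an
interval. -/
theorem PosForm.segment {B A : Op n} (hB : PosForm B) {ρ ρ' : ℝ} (h0 : 0 ≤ ρ) (h : ρ ≤ ρ')
    (hA : PosForm (B + ρ' • A)) : PosForm (B + ρ • A) := by
  intro u hu
  have h1 := hB u hu
  have h2 := hA u hu
  simp only [add_apply, smul_apply, inner_add_right,
    Complex.add_re, inner_smul_right_eq_smul, Complex.smul_re, smul_eq_mul] at h2 ⊢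
  rcases h0.eq_or_lt with rfl | h0
  · simpa using h1
  have h3 : 0 < ρ' := h0.trans_le h
  by_contra! h4
  have : ρ' * ((⟪u, B u⟫_ℂ).re + ρ * (⟪u, A u⟫_ℂ).re) ≤ 0 :=
    mul_nonpos_of_nonneg_of_nonpos h3.le h4
  nlinarith

/-- `ρ (B + ρA)⁻¹ = (B/ρ + A)⁻¹`, and `B/ρ` decreases as `ρ` grows, so the inverse increases. -/
theorem traceInv_ray_mono {B A : Op n} (hB : PosForm B)
    (hs : ∀ ρ : ℝ, ((B + ρ • A : Op n) : Hilb n →ₗ[ℂ] Hilb n).IsSymmetric)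
    {ρ ρ' : ℝ} (h0 : 0 < ρ) (h : ρ ≤ ρ') (h1 : PosForm (B + ρ • A)) (h2 : PosForm (B + ρ' • A)) :
    ρ * traceInv (B + ρ • A) ≤ ρ' * traceInv (B + ρ' • A) := by
  have h3 : 0 < ρ' := h0.trans_le h
  unfold traceInv
  rw [Finset.mul_sum, Finset.mul_sum]
  refine Finset.sum_le_sum fun k _ => ?_
  generalize EuclideanSpace.single k (1 : ℂ) = u
  set p := Ring.inverse (B + ρ • A) u with hp
  -- With this test vector the variational bound exceeds `ρ ⟪u, p⟫` exactly by `ρ (1 - ρ/ρ') ⟪p, B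
  -- p⟫ ≥ 0`.
  have h4 := h2.le_inverse (hs ρ') u ((ρ / ρ') • p)
  have h5 : (⟪p, (B + ρ • A) p⟫_ℂ).re = (⟪u, p⟫_ℂ).re := by
    rw [h1.apply_inverse u]; exact inner_re_symm (𝕜 := ℂ) p u
  have h6 : (⟪p, u⟫_ℂ).re = (⟪u, p⟫_ℂ).re := inner_re_symm (𝕜 := ℂ) p u
  have hB' : 0 ≤ (⟪p, B p⟫_ℂ).re := by
    by_cases hp0 : p = 0
    · simp [hp0]
    · exact (hB p hp0).le
  have e4 : (⟪(ρ / ρ') • p, (B + ρ' • A) ((ρ / ρ') • p)⟫_ℂ).re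
      = (ρ / ρ') ^ 2 * ((⟪p, B p⟫_ℂ).re + ρ' * (⟪p, A p⟫_ℂ).re) := by
    rw [← Complex.coe_smul (ρ / ρ') p]
    simp only [map_smul, inner_smul_left, inner_smul_right, Complex.conj_ofReal,
      Complex.re_ofReal_mul, add_apply, smul_apply,
      inner_add_right, inner_smul_right_eq_smul, Complex.smul_re, smul_eq_mul, Complex.add_re]
    ring
  have e5 : (⟪(ρ / ρ') • p, u⟫_ℂ).re = ρ / ρ' * (⟪p, u⟫_ℂ).re := by
    rw [← Complex.coe_smul (ρ / ρ') p, inner_smul_left, Complex.conj_ofReal, Complex.re_ofReal_mul]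
  rw [e4, e5, h6] at h4
  simp only [add_apply, smul_apply, inner_add_right,
    inner_smul_right_eq_smul, Complex.smul_re, smul_eq_mul, Complex.add_re] at h5
  calc ρ * (⟪u, p⟫_ℂ).re ≤ ρ * (⟪u, p⟫_ℂ).re + ρ * (1 - ρ / ρ') * (⟪p, B p⟫_ℂ).re := by
        have : 0 ≤ 1 - ρ / ρ' := by rw [sub_nonneg, div_le_one h3]; exact h
        have := mul_nonneg (mul_nonneg h0.le this) hB'
        linarith
    _ = ρ' * (2 * (ρ / ρ' * (⟪u, p⟫_ℂ).re) -
        (ρ / ρ') ^ 2 * ((⟪p, B p⟫_ℂ).re + ρ' * (⟪p, A p⟫_ℂ).re)) := by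
        have : (⟪p, A p⟫_ℂ).re = ((⟪u, p⟫_ℂ).re - (⟪p, B p⟫_ℂ).re) / ρ := by
          field_simp; linarith
        rw [this]; field_simp; ring
    _ ≤ _ := by gcongr

/-- The summand `1` makes the monotonicity strict; it also covers `ρ = 0`. -/
theorem ray_scaling_lt {B A : Op n} (hB : PosForm B)
    (hs : ∀ ρ : ℝ, ((B + ρ • A : Op n) : Hilb n →ₗ[ℂ] Hilb n).IsSymmetric)
    {ρ ρ' : ℝ} (h0 : 0 ≤ ρ) (h : ρ < ρ') (h2 : PosForm (B + ρ' • A)) :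
    ρ * (1 + traceInv (B + ρ • A)) < ρ' * (1 + traceInv (B + ρ' • A)) := by
  rcases h0.eq_or_lt with rfl | h0
  · have := h2.traceInv_nonneg (hs ρ')
    rw [zero_mul]
    positivity
  · have := traceInv_ray_mono hB hs h0 h.le (hB.segment h0.le h.le h2) h2
    linarith

/-- The function starts at `0`. If it never reached `1`, the trace would stay below `1/ρ`, so the
form would stay above `ρ ‖u‖²` and positivity could not be lost along the ray. Then `ρ = 1` would be
admissible, where the value is at least `1`. -/
theorem exists_ray_scaling_eq {B A : Op n} (hB : PosForm B)
    (hs : ∀ ρ : ℝ, ((B + ρ • A : Op n) : Hilb n →ₗ[ℂ] Hilb n).IsSymmetric) :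
    ∃ ρ : ℝ, PosForm (B + ρ • A) ∧ ρ * (1 + traceInv (B + ρ • A)) = 1 := by
  have hcont : Continuous fun ρ : ℝ => B + ρ • A := by fun_prop
  set φ : ℝ → ℝ := fun ρ => ρ * (1 + traceInv (B + ρ • A)) with hφ
  set J : Set ℝ := {ρ | PosForm (B + ρ • A)} with hJ
  have h0J : (0 : ℝ) ∈ J := by
    change PosForm (B + (0 : ℝ) • A)
    have h : (0 : ℝ) • A = 0 := by ext u : 1; simp
    rwa [h, add_zero]
  have hJo : IsOpen J := isOpen_posForm.preimage hcont
  have hφc : ContinuousOn φ J := fun ρ hρ => by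
    have := (contDiffAt_traceInv (G := B + ρ • A) hρ).continuousAt
    have h2 : ContinuousAt (fun ρ : ℝ => traceInv (B + ρ • A)) ρ :=
      ContinuousAt.comp (f := fun ρ : ℝ => B + ρ • A) this hcont.continuousAt
    exact (continuousAt_id.mul (continuousAt_const.add h2)).continuousWithinAt
  have hIVT : ∀ ρ ∈ J, 0 ≤ ρ → 1 ≤ φ ρ → ∃ ρ : ℝ, PosForm (B + ρ • A) ∧ φ ρ = 1 := by
    intro ρ hρ h0 h1
    have hsub : Set.Icc 0 ρ ⊆ J := fun r hr => hB.segment hr.1 hr.2 hρ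
    obtain ⟨r, hr, hr1⟩ := intermediate_value_Icc h0 (hφc.mono hsub)
      (show (1 : ℝ) ∈ Set.Icc (φ 0) (φ ρ) from ⟨by simp [hφ], h1⟩)
    exact ⟨r, hsub hr, hr1⟩
  by_contra hne
  have hlt : ∀ ρ ∈ J, 0 ≤ ρ → φ ρ < 1 := fun ρ hρ h0 => by
    by_contra! h
    exact hne (hIVT ρ hρ h0 h)
  -- Under the contradiction hypothesis the open set `J` and this closed set have the same
  -- nonnegative points, so a connectedness argument gives `[0, 1] ⊆ J`.
  set C : Set ℝ := {ρ | ∀ u : Hilb n, ρ * ‖u‖ ^ 2 ≤ (⟪u, (B + ρ • A) u⟫_ℂ).re} with hC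
  have hCc : IsClosed C := by
    have : C = ⋂ u : Hilb n, {ρ : ℝ | ρ * ‖u‖ ^ 2 ≤ (⟪u, (B + ρ • A) u⟫_ℂ).re} := by
      ext; simp [hC]
    rw [this]
    refine isClosed_iInter fun u => isClosed_le (by fun_prop) ?_
    exact Complex.continuous_re.comp (continuous_const.inner (by fun_prop))
  have hJC : ∀ ρ ∈ J, 0 ≤ ρ → ρ ∈ C := fun ρ hρ h0 u => by
    rcases h0.eq_or_lt with rfl | h0
    · rw [zero_mul]
      by_cases hu : u = 0
      · simp [hu]
      · exact (hρ u hu).le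
    have h1 := hlt ρ hρ h0.le
    have h2 : traceInv (B + ρ • A) ≤ ρ⁻¹ := by
      rw [← one_div, le_div_iff₀ h0]
      have : φ ρ = ρ + traceInv (B + ρ • A) * ρ := by simp only [hφ]; ring
      linarith
    have h3 := PosForm.lower_bound_of_traceInv_le hρ (hs ρ) h2 u
    calc _ ≤ ρ * (ρ⁻¹ * (⟪u, (B + ρ • A) u⟫_ℂ).re) := by gcongr
      _ = _ := by field_simp
  have hCJ : ∀ ρ ∈ C, 0 ≤ ρ → ρ ∈ J := fun ρ hρ h0 => by
    rcases h0.eq_or_lt with rfl | h0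
    · exact h0J
    · exact fun u hu => lt_of_lt_of_le (by positivity) (hρ u)
  have hall : Set.Icc (0 : ℝ) 1 ⊆ C := by
    refine (hCc.inter isClosed_Icc).Icc_subset_of_forall_mem_nhdsWithin (hJC 0 h0J le_rfl) ?_
    intro ρ hρ
    have : ∀ᶠ r in nhdsWithin ρ (Set.Ioi ρ), r ∈ J :=
      nhdsWithin_le_nhds (hJo.mem_nhds (hCJ ρ hρ.1 hρ.2.1))
    filter_upwards [this, self_mem_nhdsWithin] with r hr hr'
    exact hJC r hr (hρ.2.1.trans (le_of_lt hr'))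
  have h1J : (1 : ℝ) ∈ J := hCJ 1 (hall ⟨zero_le_one, le_rfl⟩) zero_le_one
  have := hlt 1 h1J zero_le_one
  have h2 := PosForm.traceInv_nonneg h1J (hs 1)
  simp only [hφ] at this
  linarith

end Ray

/-- On each ray `r ↦ r (1 + tr Γ(w, r y)⁻¹)` is strictly increasing and takes every value that is
needed, so the radial map `η` is bijective from each fibre onto `Y`. Its derivative is injective,
hence the inverse `κ` is smooth jointly in `w`. -/
theorem exists_fibrewise_diffeo {n : ℕ} {W Y : Type*} [NormedAddCommGroup W] [NormedSpace ℝ W]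
    [FiniteDimensional ℝ W] [NormedAddCommGroup Y] [NormedSpace ℝ Y] [FiniteDimensional ℝ Y]
    {O : Set W} (hO : IsOpen O) {Γ : W × Y → Op n} (hΓ : ContDiffOn ℝ ∞ Γ (O ×ˢ Set.univ))
    (hs : ∀ p, (Γ p : Hilb n →ₗ[ℂ] Hilb n).IsSymmetric)
    (hray : ∀ w ∈ O, ∀ (y : Y) (r : ℝ), Γ (w, r • y) = Γ (w, 0) + r • (Γ (w, y) - Γ (w, 0)))
    (h0 : ∀ w ∈ O, PosForm (Γ (w, 0))) :
    ∃ η κ : W × Y → Y,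
      ContDiffOn ℝ ∞ η {p | p.1 ∈ O ∧ PosForm (Γ p)} ∧ ContDiffOn ℝ ∞ κ (O ×ˢ Set.univ) ∧
      (∀ w ∈ O, ∀ y, PosForm (Γ (w, y)) → κ (w, η (w, y)) = y) ∧
      ∀ w ∈ O, ∀ t, PosForm (Γ (w, κ (w, t))) ∧ η (w, κ (w, t)) = t := by
  set U : Set (W × Y) := {p | p.1 ∈ O ∧ PosForm (Γ p)} with hU
  have hOu : IsOpen (O ×ˢ (Set.univ : Set Y)) := hO.prod isOpen_univ
  have hUo : IsOpen U := by
    have := hΓ.continuousOn.isOpen_inter_preimage hOu isOpen_posForm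
    convert! this using 1
    ext p
    simp [hU]
  have hUsub : U ⊆ O ×ˢ Set.univ := fun p hp => ⟨hp.1, trivial⟩
  set T : W × Y → ℝ := fun p => traceInv (Γ p) with hT
  have hTc : ContDiffOn ℝ ∞ T U := fun p hp =>
    ((contDiffAt_traceInv hp.2).comp p
      (hΓ.contDiffAt (hOu.mem_nhds (hUsub hp)))).contDiffWithinAt
  have hT0 : ∀ p ∈ U, 0 ≤ T p := fun p hp => hp.2.traceInv_nonneg (hs p)
  set η : W × Y → Y := fun p => (1 + T p) • p.2 with hη
  have hηc : ContDiffOn ℝ ∞ η U := (contDiffOn_const.add hTc).smul contDiffOn_snd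
  have hsray : ∀ w ∈ O, ∀ (y : Y) (r : ℝ),
      ((Γ (w, 0) + r • (Γ (w, y) - Γ (w, 0)) : Op n) : Hilb n →ₗ[ℂ] Hilb n).IsSymmetric :=
    fun w hw y r => by rw [← hray w hw]; exact hs _
  have hrayU : ∀ w ∈ O, ∀ y : Y, PosForm (Γ (w, y)) →
      PosForm (Γ (w, 0) + (1 : ℝ) • (Γ (w, y) - Γ (w, 0))) := fun w hw y hy => by
    rwa [← hray w hw, one_smul]
  set Φ : W × Y → W × Y := fun p => (p.1, η p) with hΦ
  have hΦc : ContDiffOn ℝ ∞ Φ U := contDiffOn_fst.prodMk hηc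
  have hlt : ∀ w ∈ O, ∀ y : Y, PosForm (Γ (w, y)) → ∀ r : ℝ, 0 ≤ r → r < 1 →
      r * (1 + T (w, r • y)) < 1 + T (w, y) := fun w hw y hy r hr hr1 => by
    have := ray_scaling_lt (h0 w hw) (hsray w hw y) hr hr1 (hrayU w hw y hy)
    rwa [← hray w hw, ← hray w hw, one_smul, one_mul] at this
  have hinj : Set.InjOn Φ U := by
    rintro ⟨w, y⟩ hp ⟨w', y'⟩ hp' heq
    obtain ⟨rfl, heq⟩ := Prod.mk.inj heq
    have key : ∀ y y' : Y, PosForm (Γ (w, y)) → PosForm (Γ (w, y')) →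
        (1 + T (w, y)) • y = (1 + T (w, y')) • y' → T (w, y) ≤ T (w, y') → y = y' := by
      intro y y' hy hy' heq hle
      have h1 : 0 < 1 + T (w, y) := by linarith [hT0 (w, y) ⟨hp.1, hy⟩]
      have h2 : 0 < 1 + T (w, y') := by linarith
      by_contra hne
      rcases hle.eq_or_lt with hle | hle
      · rw [← hle] at heq
        exact hne (smul_right_injective Y h1.ne' heq)
      -- Equal images lie on one ray. The point with the larger trace is the shorter one, `y' = r •
      -- y` with `r < 1`, against the strict monotonicity.
      · set r := (1 + T (w, y)) / (1 + T (w, y')) with hr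
        have hy'r : y' = r • y := by
          rw [hr, div_eq_inv_mul, mul_smul, heq, smul_smul, inv_mul_cancel₀ h2.ne', one_smul]
        have h3 := hlt w hp.1 y hy r (by positivity) (by rw [hr, div_lt_one h2]; linarith)
        rw [← hy'r, hr, div_mul_cancel₀ _ h2.ne'] at h3
        exact lt_irrefl _ h3
    rcases le_total (T (w, y)) (T (w, y')) with h | h
    · rw [key y y' hp.2 hp'.2 heq h]
    · rw [key y' y hp'.2 hp.2 heq.symm h]
  have hder : ∀ p ∈ U, ∃ e' : (W × Y) ≃L[ℝ] (W × Y),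
      HasFDerivAt Φ (e' : (W × Y) →L[ℝ] (W × Y)) p := by
    rintro ⟨w, y⟩ hp
    have hTd : HasFDerivAt T (fderiv ℝ T (w, y)) (w, y) :=
      ((hTc.contDiffAt (hUo.mem_nhds hp)).differentiableAt (by simp)).hasFDerivAt
    obtain ⟨Φ', hΦd, hΦ'⟩ : ∃ Φ' : (W × Y) →L[ℝ] (W × Y), HasFDerivAt Φ Φ' (w, y) ∧
        ∀ q, Φ' q = (q.1, (1 + T (w, y)) • q.2 + fderiv ℝ T (w, y) q • y) :=
      ⟨_, hasFDerivAt_fst.prodMk ((hTd.const_add 1).smul hasFDerivAt_snd), fun _ => rfl⟩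
    obtain ⟨e, he⟩ : ∃ e : (W × Y) ≃L[ℝ] (W × Y), (e : (W × Y) →L[ℝ] (W × Y)) = Φ' := by
      refine exists_equiv_of_injective Φ' ?_
      rintro ⟨a, v⟩ hv
      rw [hΦ', Prod.mk_eq_zero] at hv
      obtain ⟨rfl : a = 0, hv⟩ := hv
      simp only at hv
      have h1 : 0 < 1 + T (w, y) := by linarith [hT0 (w, y) hp]
      -- A kernel vector has no `W` component and is radial, `v = c • y`. In the radial direction
      -- `η` stretches by `1 + T + L (0, y)`, so it suffices that `T + L (0, y) ≥ 0`.
      set L := fderiv ℝ T (w, y)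
      set c := -(1 + T (w, y))⁻¹ * L (0, v) with hc
      have hvc : v = c • y := by
        have : (1 + T (w, y)) • v = -(L (0, v) • y) := eq_neg_of_add_eq_zero_left hv
        rw [hc, mul_smul, neg_smul, ← smul_neg, ← this, smul_smul, inv_mul_cancel₀ h1.ne', one_smul]
      have hLv : L (0, v) = c * L (0, y) := by
        rw [hvc, ← smul_eq_mul, ← map_smul, Prod.smul_mk, smul_zero]
      have hpos : 0 ≤ T (w, y) + L (0, y) := by
        have hcurve : HasDerivAt (fun r : ℝ => (w, r • y)) ((0 : W), y) 1 := by
          have h1 : HasDerivAt (fun r : ℝ => r • y) ((1 : ℝ) • y) 1 :=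
            (hasDerivAt_id (1 : ℝ)).smul_const y
          rw [one_smul] at h1
          exact (hasDerivAt_const (1 : ℝ) w).prodMk h1
        have hcomp : HasDerivAt (fun r : ℝ => T (w, r • y)) (L (0, y)) 1 :=
          HasFDerivAt.comp_hasDerivAt (l := T) (1 : ℝ) (by rw [one_smul]; exact hTd) hcurve
        have hd := (hasDerivAt_id (1 : ℝ)).mul hcomp
        simp only [one_smul, one_mul, id] at hd
        -- `T + L (0, y)` is the derivative of `r * T (w, r • y)` at `r = 1`. Convexity provides
        -- positivity for `r ≤ 1`, so a one-sided derivative is used; the end `1 / 2` only keeps `r`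
        -- positive.
        set s : Set ℝ := Set.Icc (1 / 2) 1
        have hmono : MonotoneOn (fun r : ℝ => r * T (w, r • y)) s := by
          intro r hr r' hr' hrr
          have hr0 : (0 : ℝ) < r := lt_of_lt_of_le (by norm_num) hr.1
          have hr0' : (0 : ℝ) < r' := lt_of_lt_of_le (by norm_num) hr'.1
          have hy1 := hrayU w hp.1 y hp.2
          have := traceInv_ray_mono (h0 w hp.1) (hsray w hp.1 y) hr0 hrr
            ((h0 w hp.1).segment hr0.le hr.2 hy1) ((h0 w hp.1).segment hr0'.le hr'.2 hy1)
          rwa [← hray w hp.1, ← hray w hp.1] at this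
        have h2 : 0 ≤ derivWithin (fun r : ℝ => r * T (w, r • y)) s 1 := hmono.derivWithin_nonneg
        have h3 : HasDerivWithinAt (fun r : ℝ => r * T (w, r • y)) (T (w, y) + L (0, y)) s 1 :=
          hd.hasDerivWithinAt
        rwa [h3.derivWithin (uniqueDiffOn_Icc (by norm_num) 1 ⟨by norm_num, le_rfl⟩)] at h2
      rw [hLv, hvc, smul_smul, ← add_smul] at hv
      have h4 : (c * (1 + (T (w, y) + L (0, y)))) • y = 0 := by
        rw [← hv]; congr 1; ring
      rw [mul_comm, mul_smul, ← hvc] at h4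
      have : v = 0 := (smul_eq_zero.1 h4).resolve_left (by positivity)
      rw [this]
      rfl
    exact ⟨e, he ▸ hΦd⟩
  obtain ⟨Ψ, hΨc, hΨ⟩ := exists_smooth_inverse hUo hΦc hinj hder
  have hsurj : ∀ w ∈ O, ∀ t : Y, ∃ y, PosForm (Γ (w, y)) ∧ η (w, y) = t := by
    intro w hw t
    obtain ⟨r, hr, hr1⟩ := exists_ray_scaling_eq (h0 w hw) (hsray w hw t)
    rw [← hray w hw] at hr hr1
    refine ⟨r • t, hr, ?_⟩
    simp only [hη, hT]
    rw [smul_smul, mul_comm, hr1, one_smul]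
  have himage : O ×ˢ Set.univ ⊆ Φ '' U := by
    rintro ⟨w, t⟩ ⟨hw, -⟩
    obtain ⟨y, hy, rfl⟩ := hsurj w hw t
    exact ⟨(w, y), ⟨hw, hy⟩, rfl⟩
  have hleft : ∀ w ∈ O, ∀ y, PosForm (Γ (w, y)) → (Ψ (w, η (w, y))).2 = y :=
    fun w hw y hy => congrArg Prod.snd (hΨ (w, y) ⟨hw, hy⟩)
  refine ⟨η, fun p => (Ψ p).2, hηc, contDiff_snd.comp_contDiffOn (hΨc.mono himage), hleft, ?_⟩
  intro w hw t
  obtain ⟨y, hy, rfl⟩ := hsurj w hw t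
  simp only [hleft w hw y hy]
  exact ⟨hy, trivial⟩

/-! ### Retracts are submanifolds -/

section Retraction

variable {E : Type*} [NormedAddCommGroup E] [NormedSpace ℝ E] [FiniteDimensional ℝ E]

/-- A smooth retraction `r` onto `S` has a projection `P` as derivative at `w₀`. The map `f` below
straightens `S` onto the range of `P`. -/
theorem exists_slice_of_retraction {w₀ : E} {r : E → E} {O S : Set E} (hO : IsOpen O)
    (hw₀ : w₀ ∈ O) (hr : ContDiffOn ℝ ∞ r O) (hr₀ : r w₀ = w₀) (hrS : ∀ w ∈ O, r w ∈ S)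
    (hSr : ∀ w ∈ S ∩ O, r w = w) :
    ∃ φ : OpenPartialHomeomorph E E, w₀ ∈ φ.source ∧ φ.source ⊆ O ∧
      ContDiffOn ℝ ∞ φ φ.source ∧ ContDiffOn ℝ ∞ φ.symm φ.target ∧
      φ '' (φ.source ∩ S) = φ.target ∩ (LinearMap.range (fderiv ℝ r w₀).toLinearMap : Set E) := by
  have : CompleteSpace E := FiniteDimensional.complete ℝ E
  set P := fderiv ℝ r w₀ with hP
  have hrd : HasFDerivAt r P w₀ :=
    ((hr.contDiffAt (hO.mem_nhds hw₀)).differentiableAt (by simp)).hasFDerivAt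
  set O₁ := O ∩ r ⁻¹' O with hO₁
  have hO₁o : IsOpen O₁ := hr.continuousOn.isOpen_inter_preimage hO hO
  have hw₁ : w₀ ∈ O₁ := ⟨hw₀, by rwa [Set.mem_preimage, hr₀]⟩
  have hidem : ∀ w ∈ O₁, r (r w) = r w := fun w hw => hSr _ ⟨hrS w hw.1, hw.2⟩
  have hPP : ∀ v, P (P v) = P v := by
    have h1 : HasFDerivAt (r ∘ r) (P.comp P) w₀ :=
      HasFDerivAt.comp w₀ (by rw [hr₀]; exact hrd) hrd
    have h2 : HasFDerivAt (r ∘ r) P w₀ := hrd.congr_of_eventuallyEq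
      (Filter.eventually_of_mem (hO₁o.mem_nhds hw₁) hidem)
    exact fun v => DFunLike.congr_fun (h1.unique h2) v
  -- The derivative at `w₀` is `P P + (1 - P)(1 - P) = 1`. On `S` the second part vanishes, so the
  -- values lie in the range of `P`.
  set f : E → E := fun w => P (r w - w₀) + ((w - r w) - P (w - r w)) with hf
  have hfc : ContDiffOn ℝ ∞ f O₁ := by
    have hr' : ContDiffOn ℝ ∞ r O₁ := hr.mono Set.inter_subset_left
    have h1 : ContDiffOn ℝ ∞ (fun w => w - r w) O₁ := contDiffOn_id.sub hr'
    exact (P.contDiff.comp_contDiffOn (hr'.sub contDiffOn_const)).add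
      (h1.sub (P.contDiff.comp_contDiffOn h1))
  have hfd : HasFDerivAt f ((ContinuousLinearEquiv.refl ℝ E : E ≃L[ℝ] E) : E →L[ℝ] E) w₀ := by
    have h1 : HasFDerivAt (fun w => w - r w) (ContinuousLinearMap.id ℝ E - P) w₀ :=
      (hasFDerivAt_id w₀).sub hrd
    have h2 := (P.hasFDerivAt.comp w₀ (hrd.sub_const w₀)).add
      (h1.sub (P.hasFDerivAt.comp w₀ h1))
    refine h2.congr_fderiv ?_
    ext v
    simp [hPP]
  obtain ⟨e, he, hwe, heO, hes⟩ := exists_smooth_openPartialHomeomorph hO₁o hfc hw₁ hfd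
  have hrO₁ : ContinuousOn r e.source := (hr.continuousOn.mono fun w hw => (heO hw).1)
  -- Both `w` and `r w` must lie where `f` is injective: if `f w` is in the range of `P`, then `f (r
  -- w) = f w`, and injectivity gives `r w = w`, so `w ∈ S`.
  have hs : IsOpen (e.source ∩ r ⁻¹' e.source) :=
    hrO₁.isOpen_inter_preimage e.open_source e.open_source
  set φ := e.restrOpen _ hs with hφ
  have hφf : ∀ w, φ w = f w := fun w => by rw [← he]; rfl
  have hφs : φ.source ⊆ e.source := fun w hw => hw.1
  have hPf : ∀ w, P (f w) = P (r w - w₀) := fun w => by simp [hf, hPP]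
  refine ⟨φ, ⟨hwe, hwe, by rwa [Set.mem_preimage, hr₀]⟩, fun w hw => (heO (hφs hw)).1, ?_, ?_, ?_⟩
  · exact (hfc.mono fun w hw => heO (hφs hw)).congr fun w _ => hφf w
  · exact hes.mono fun y hy => hy.1
  · ext y
    constructor
    · rintro ⟨w, ⟨hw, hwS⟩, rfl⟩
      refine ⟨φ.map_source hw, w - w₀, ?_⟩
      rw [hφf]
      simp [hf, hSr w ⟨hwS, (heO (hφs hw)).1⟩]
    · rintro ⟨hy, v, hv⟩
      have hw := φ.map_target hy
      set w := φ.symm y with hwdef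
      have hyw : f w = y := by rw [← hφf]; exact φ.right_inv hy
      have hPy : P y = y := by rw [← hv]; exact hPP v
      have h1 : f (r w) = f w := by
        rw [hyw, ← hPy, ← hyw, hPf]
        simp [hf, hidem w (heO (hφs hw))]
      have h2 : r w = w := by
        refine e.injOn hw.2.2 hw.1 ?_
        rw [he]
        exact h1
      exact ⟨w, ⟨hw, h2 ▸ hrS w (heO (hφs hw)).1⟩, by rw [hφf, hyw]⟩

end Retraction

/-! ### Families of linear systems of constant rank -/

section LinearSystems

variable {E F : Type*} [NormedAddCommGroup E] [NormedSpace ℝ E] [FiniteDimensional ℝ E]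
  [NormedAddCommGroup F] [NormedSpace ℝ F]

/-- `ρ` is a coordinate on the kernel of `T` and `Q` inverts `T` on a complement. The identity `Q T
+ ι ρ = 1` becomes mere invertibility when `T` is perturbed, which is an open condition. -/
theorem exists_splitting [FiniteDimensional ℝ F] (T : E →L[ℝ] F) {k : ℕ}
    (hk : Module.finrank ℝ (LinearMap.ker T.toLinearMap) = k) :
    ∃ (Q : F →L[ℝ] E) (ι : EuclideanSpace ℝ (Fin k) →L[ℝ] E) (ρ : E →L[ℝ] EuclideanSpace ℝ (Fin k)),
      (∀ t, ρ (ι t) = t) ∧ (∀ u, ρ (Q u) = 0) ∧ ∀ z, Q (T z) + ι (ρ z) = z := by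
  obtain ⟨p, hp⟩ := (LinearMap.ker T.toLinearMap).subtype.exists_leftInverse_of_injective
    (Submodule.ker_subtype _)
  have hp' : ∀ z : LinearMap.ker T.toLinearMap, p z = z := fun z => DFunLike.congr_fun hp z
  let e : EuclideanSpace ℝ (Fin k) ≃ₗ[ℝ] LinearMap.ker T.toLinearMap :=
    LinearEquiv.ofFinrankEq _ _ (by rw [hk, finrank_euclideanSpace_fin])
  obtain ⟨h, hh⟩ := T.toLinearMap.rangeRestrict.exists_rightInverse_of_surjective
    T.toLinearMap.range_rangeRestrict
  obtain ⟨g, hg⟩ := h.exists_extend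
  have hTg : ∀ z, T (g (T z)) = T z := fun z => by
    have h1 : g (T z) = h ⟨T z, z, rfl⟩ := DFunLike.congr_fun hg ⟨T z, z, rfl⟩
    rw [h1]
    exact congrArg Subtype.val (DFunLike.congr_fun hh ⟨T z, z, rfl⟩)
  let ι : EuclideanSpace ℝ (Fin k) →ₗ[ℝ] E := (LinearMap.ker T.toLinearMap).subtype ∘ₗ e
  let ρ : E →ₗ[ℝ] EuclideanSpace ℝ (Fin k) := (e.symm : _ →ₗ[ℝ] _) ∘ₗ p
  have hρι : ∀ t, ρ (ι t) = t := fun t => by simp [ρ, ι, hp']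
  have hιρ : ∀ z, T z = 0 → ι (ρ z) = z := fun z hz => by
    have := hp' ⟨z, hz⟩
    simp only at this
    simp [ρ, ι, this]
  let Q : F →ₗ[ℝ] E := (LinearMap.id - ι ∘ₗ ρ) ∘ₗ g
  refine ⟨Q.toContinuousLinearMap, ι.toContinuousLinearMap, ρ.toContinuousLinearMap, hρι,
    fun u => ?_, fun z => ?_⟩
  · simp [Q, hρι]
  · have h1 := hιρ (g (T z) - z) (by rw [map_sub, hTg, sub_self])
    simp only [map_sub] at h1
    simp only [LinearMap.coe_toContinuousLinearMap', Q, LinearMap.comp_apply, LinearMap.sub_apply,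
      LinearMap.id_apply]
    have h2 : ι (ρ (g (T z))) = g (T z) - z + ι (ρ z) := eq_add_of_sub_eq h1
    rw [h2]
    abel

/-- Among systems with kernels of the same dimension, `Q` detects the solvable right-hand sides. -/
theorem eq_zero_of_splitting {k : ℕ} {T : E →L[ℝ] F} {Q : F →L[ℝ] E}
    {ι : EuclideanSpace ℝ (Fin k) →L[ℝ] E} {ρ : E →L[ℝ] EuclideanSpace ℝ (Fin k)}
    (hinj : ∀ z, Q (T z) + ι (ρ z) = 0 → z = 0)
    (hk : Module.finrank ℝ (LinearMap.ker T.toLinearMap) = k) {z : E} (hz : Q (T z) = 0) :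
    T z = 0 := by
  set f := ρ.toLinearMap.domRestrict (LinearMap.ker T.toLinearMap)
  have hf : Function.Injective f := by
    rw [injective_iff_map_eq_zero]
    rintro ⟨y, hy⟩ h
    have hy' : T y = 0 := hy
    have h' : ρ y = 0 := h
    exact Subtype.ext (hinj y (by simp [hy', h']))
  -- `ρ` is injective on the kernel, hence bijective by the dimension count. Subtracting the kernel
  -- vector with the same `ρ` as `z` leaves a vector killed by `Q T + ι ρ`.
  have hs : Function.Surjective f :=
    (LinearMap.injective_iff_surjective_of_finrank_eq_finrank
      (by rw [hk, finrank_euclideanSpace_fin])).1 hf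
  obtain ⟨⟨y, hy⟩, h⟩ := hs (ρ z)
  have hy' : T y = 0 := hy
  have h' : ρ y = ρ z := h
  have : z - y = 0 := hinj _ (by simp [hy', h', hz])
  rw [sub_eq_zero.1 this, hy']

end LinearSystems

/-! ### A positivity criterion for a simple lowest eigenvalue -/

section Criterion

variable {n : ℕ}

/-- The rank one operator `|v⟩⟨v|`. -/
def ketBra (v : Hilb n) : Op n := (innerSL ℂ v).smulRight v

@[simp]
theorem ketBra_apply (v u : Hilb n) : ketBra v u = ⟪v, u⟫_ℂ • v := rfl

theorem isSymmetric_ketBra (v : Hilb n) : (ketBra v : Hilb n →ₗ[ℂ] Hilb n).IsSymmetric := by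
  intro x y
  simp [inner_smul_left, inner_smul_right, mul_comm]

theorem contDiff_ketBra : ContDiff ℝ ∞ (ketBra : Hilb n → Op n) := by
  -- The bra is conjugate-linear in `v`, so it is smooth only over `ℝ`.
  let B : Hilb n →ₗ[ℝ] (Hilb n →L[ℂ] ℂ) :=
    { toFun := fun v => innerSL ℂ v
      map_add' := fun u v => map_add _ u v
      map_smul' := fun r v => by
        ext u
        simp [inner_smul_left_eq_smul] }
  have h1 : ContDiff ℝ ∞ fun v : Hilb n => innerSL ℂ v := B.toContinuousLinearMap.contDiff
  have h2 : ContDiff ℝ ∞ fun p : (Hilb n →L[ℂ] ℂ) × Hilb n => p.1.smulRight p.2 :=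
    (isBoundedBilinearMap_smulRight (𝕜 := ℂ) (E := Hilb n) (F := Hilb n)).contDiff.restrict_scalars ℝ
  exact ContDiff.comp (f := fun v : Hilb n => (innerSL ℂ v, v)) h2 (h1.prodMk contDiff_id)

/-- The infimum of the Rayleigh quotient of a symmetric operator is an eigenvalue. -/
theorem posForm_of_eigenvalues_pos {G : Op n} (hs : (G : Hilb n →ₗ[ℂ] Hilb n).IsSymmetric)
    (h : ∀ (μ : ℝ) (u : Hilb n), u ≠ 0 → G u = (μ : ℂ) • u → 0 < μ) : PosForm G := by
  obtain ⟨u₀, hu₀⟩ := hs.hasEigenvalue_iInf_of_finiteDimensional.exists_hasEigenvector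
  have hpos := h _ u₀ hu₀.2 hu₀.apply_eq_smul
  intro u hu
  have hb : BddBelow (Set.range fun x : {x : Hilb n // x ≠ 0} =>
      RCLike.re ⟪(G : Hilb n →ₗ[ℂ] Hilb n) x, (x : Hilb n)⟫_ℂ / ‖(x : Hilb n)‖ ^ 2) := by
    refine ⟨-‖G‖, ?_⟩
    rintro _ ⟨x, rfl⟩
    exact (abs_le.1 (G.rayleighQuotient_le_norm x.1)).1
  have h1 := hpos.trans_le (ciInf_le hb ⟨u, hu⟩)
  have h2 : 0 < RCLike.re ⟪G u, u⟫_ℂ := by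
    have : 0 < ‖u‖ ^ 2 := by positivity
    exact (div_pos_iff_of_pos_right this).1 h1
  exact h2.trans_eq (inner_re_symm (𝕜 := ℂ) _ _)

theorem isSymmetric_shift {A : Op n} (hA : (A : Hilb n →ₗ[ℂ] Hilb n).IsSymmetric) (c : ℝ)
    (v : Hilb n) : ((A - (c : ℂ) • 1 + ketBra v : Op n) : Hilb n →ₗ[ℂ] Hilb n).IsSymmetric := by
  intro x y
  have h1 := hA x y
  have h2 := isSymmetric_ketBra v x y
  simp only [ContinuousLinearMap.coe_coe] at h1 h2
  simp [inner_add_left, inner_sub_left, inner_add_right, inner_sub_right, inner_smul_left,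
    inner_smul_right, inner_smul_left_eq_smul, inner_smul_right_eq_smul, h1, mul_comm]

/-- Subtracting `c` puts the level of `v` at `0`; the rank one term lifts it to `‖v‖²` and leaves
the orthogonal complement alone. Positivity thus says that the rest of the spectrum lies strictly
above `c`. This replaces a statement about eigenspaces by an equation and an open condition. -/
theorem simple_ground_iff {A : Op n} (hA : (A : Hilb n →ₗ[ℂ] Hilb n).IsSymmetric) {v : Hilb n}
    (hv : v ≠ 0) :
    Module.End.eigenspace (A : Hilb n →ₗ[ℂ] Hilb n)
      ((sInf {μ : ℝ | Module.End.HasEigenvalue (A : Hilb n →ₗ[ℂ] Hilb n) (μ : ℂ)} : ℝ) : ℂ)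
        = Submodule.span ℂ {v} ↔
    ∃ c : ℝ, A v = (c : ℂ) • v ∧ PosForm (A - (c : ℂ) • 1 + ketBra v) := by
  set S := {μ : ℝ | Module.End.HasEigenvalue (A : Hilb n →ₗ[ℂ] Hilb n) (μ : ℂ)} with hS
  have hvv : ⟪v, v⟫_ℂ ≠ 0 := inner_self_ne_zero.2 hv
  have happ : ∀ (c : ℝ) (u : Hilb n),
      (A - (c : ℂ) • 1 + ketBra v) u = A u - (c : ℂ) • u + ⟪v, u⟫_ℂ • v := fun c u => by simp
  have hmem : ∀ {μ : ℝ} {u : Hilb n}, u ≠ 0 → A u = (μ : ℂ) • u → μ ∈ S := fun hu h =>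
    Module.End.hasEigenvalue_of_hasEigenvector (Module.End.hasEigenvector_iff.2
      ⟨Module.End.mem_eigenspace_iff.2 h, hu⟩)
  have horth : ∀ {c μ : ℝ} {u : Hilb n}, A v = (c : ℂ) • v → A u = (μ : ℂ) • u → μ ≠ c →
      ⟪v, u⟫_ℂ = 0 := by
    intro c μ u hc hu hne
    have h1 : ⟪A v, u⟫_ℂ = ⟪v, A u⟫_ℂ := hA v u
    rw [hc, hu, inner_smul_left, inner_smul_right, Complex.conj_ofReal] at h1
    have h2 : ((c : ℂ) - μ) * ⟪v, u⟫_ℂ = 0 := by linear_combination h1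
    refine (mul_eq_zero.1 h2).resolve_left ?_
    refine sub_ne_zero.2 ?_
    exact_mod_cast hne.symm
  constructor
  · intro h
    set c := sInf S
    have hc : A v = (c : ℂ) • v :=
      Module.End.mem_eigenspace_iff.1 (h ▸ Submodule.mem_span_singleton_self v)
    refine ⟨c, hc, posForm_of_eigenvalues_pos (isSymmetric_shift hA c v) fun ν u hu hν => ?_⟩
    rw [happ] at hν
    have h1 : ⟪v, A u⟫_ℂ = (c : ℂ) * ⟪v, u⟫_ℂ := by
      have : ⟪A v, u⟫_ℂ = ⟪v, A u⟫_ℂ := hA v u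
      rw [← this, hc, inner_smul_left, Complex.conj_ofReal]
    have h2 : ⟪v, u⟫_ℂ * ⟪v, v⟫_ℂ = (ν : ℂ) * ⟪v, u⟫_ℂ := by
      have := congrArg (fun z => ⟪v, z⟫_ℂ) hν
      simp only [inner_add_right, inner_sub_right, inner_smul_right, h1] at this
      linear_combination this
    -- An eigenvector `u` orthogonal to `v` is one of `A` with eigenvalue `c + ν`; otherwise `h2`
    -- forces `ν = ‖v‖²`.
    by_cases h3 : ⟪v, u⟫_ℂ = 0
    · rw [h3, zero_smul, add_zero] at hν
      have h4 : A u = ((c + ν : ℝ) : ℂ) • u := by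
        rw [Complex.ofReal_add, add_smul, ← hν]; abel
      have hbdd : BddBelow S := by
        have : S.Finite := (Module.End.finite_hasEigenvalue
          (A : Hilb n →ₗ[ℂ] Hilb n)).preimage Complex.ofReal_injective.injOn
        exact this.bddBelow
      have h5 : c ≤ c + ν := csInf_le hbdd (hmem hu h4)
      refine lt_of_le_of_ne (by linarith) fun h6 => hu ?_
      rw [← h6, add_zero] at h4
      have h7 : u ∈ Submodule.span ℂ {v} := h ▸ Module.End.mem_eigenspace_iff.2 h4
      obtain ⟨a, rfl⟩ := Submodule.mem_span_singleton.1 h7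
      rw [inner_smul_right] at h3
      rw [(mul_eq_zero.1 h3).resolve_right hvv, zero_smul]
    · have h4 : ⟪v, v⟫_ℂ = ν := by
        rw [mul_comm] at h2
        exact mul_right_cancel₀ h3 h2
      have h5 : (ν : ℂ) = ((‖v‖ ^ 2 : ℝ) : ℂ) := by
        rw [← h4, inner_self_eq_norm_sq_to_K]; simp
      rw [Complex.ofReal_injective h5]
      positivity
  · rintro ⟨c, hc, hpos⟩
    have hle : ∀ μ ∈ S, c ≤ μ := by
      intro μ hμ
      by_contra! hlt
      obtain ⟨u, hu⟩ := Module.End.HasEigenvalue.exists_hasEigenvector hμ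
      have hu1 : A u = (μ : ℂ) • u := hu.apply_eq_smul
      have h1 := hpos u hu.2
      rw [happ, horth hc hu1 hlt.ne, zero_smul, add_zero, hu1, ← sub_smul, inner_smul_right,
        ← Complex.ofReal_sub, Complex.re_ofReal_mul] at h1
      have h2 : 0 ≤ (⟪u, u⟫_ℂ).re := inner_self_nonneg (𝕜 := ℂ)
      nlinarith
    have hinf : sInf S = c := IsLeast.csInf_eq ⟨hmem hv hc, hle⟩
    rw [hinf]
    ext u
    rw [Module.End.mem_eigenspace_iff, Submodule.mem_span_singleton]
    constructor
    · intro hu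
      have hu1 : A u = (c : ℂ) • u := hu
      set a := ⟪v, u⟫_ℂ / ⟪v, v⟫_ℂ with ha
      refine ⟨a, ?_⟩
      by_contra hne
      have hne' : u - a • v ≠ 0 := fun h => hne (sub_eq_zero.1 h).symm
      have h1 := hpos _ hne'
      have h2 : ⟪v, u - a • v⟫_ℂ = 0 := by
        rw [inner_sub_right, inner_smul_right, ha, div_mul_cancel₀ _ hvv, sub_self]
      rw [happ, h2, map_sub, map_smul, hu1, hc] at h1
      have h3 : (c : ℂ) • u - a • (c : ℂ) • v - (c : ℂ) • (u - a • v) + (0 : ℂ) • v = 0 := by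
        rw [smul_sub, smul_comm a]; simp
      rw [h3] at h1
      simp at h1
    · rintro ⟨a, rfl⟩
      change A (a • v) = _
      rw [map_smul, hc, smul_comm]

end Criterion

/-! ### The affine family of operators with the quasi-coherent states as ground states -/

section Family

variable {D n : ℕ} (X : Fin D → Matrix (Fin (n + 1)) (Fin (n + 1)) ℂ)

/-- The operator `∑_a x^a X^a`. -/
def configOp : EuclideanSpace ℝ (Fin D) →L[ℝ] Op n :=
  ∑ a, (EuclideanSpace.proj a : EuclideanSpace ℝ (Fin D) →L[ℝ] ℝ).smulRight
    (Matrix.toEuclideanCLM (n := Fin (n + 1)) (𝕜 := ℂ) (X a) : Op n)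

/-- The operator `H_0 = ½ ∑_a (X^a)²`. -/
def originOp : Op n := Matrix.toEuclideanCLM (n := Fin (n + 1)) (𝕜 := ℂ)
  (displacementHamiltonian X 0)

theorem configOp_apply (x : EuclideanSpace ℝ (Fin D)) :
    configOp X x = Matrix.toEuclideanCLM (n := Fin (n + 1)) (𝕜 := ℂ) (∑ a, (x a : ℂ) • X a) := by
  rw [map_sum, configOp, sum_apply]
  refine Finset.sum_congr rfl fun a _ => ?_
  exact (Complex.coe_smul (x a) _).symm.trans
    (map_smul (Matrix.toEuclideanCLM (n := Fin (n + 1)) (𝕜 := ℂ)) (x a : ℂ) (X a)).symm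

/-- The part quadratic in `x` is a scalar. All affine and convex structure of the fibres rests on
this. -/
theorem displacementHamiltonian_eq (x : EuclideanSpace ℝ (Fin D)) :
    displacementHamiltonian X x = displacementHamiltonian X 0 - ∑ a, (x a : ℂ) • X a
      + ((‖x‖ ^ 2 / 2 : ℝ) : ℂ) • 1 := by
  rw [EuclideanSpace.real_norm_sq_eq]
  simp only [displacementHamiltonian, PiLp.zero_apply, Complex.ofReal_zero, zero_smul, sub_zero,
    Complex.ofReal_div, Complex.ofReal_sum, Finset.sum_div, Finset.sum_smul, Finset.smul_sum,
    ← Finset.sum_sub_distrib, ← Finset.sum_add_distrib]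
  refine Finset.sum_congr rfl fun a _ => ?_
  simp only [sq, sub_mul, mul_sub, smul_mul_assoc, mul_smul_comm, one_mul, mul_one]
  module

theorem toEuclideanCLM_displacementHamiltonian (x : EuclideanSpace ℝ (Fin D)) :
    Matrix.toEuclideanCLM (n := Fin (n + 1)) (𝕜 := ℂ) (displacementHamiltonian X x)
      = originOp X - configOp X x + ((‖x‖ ^ 2 / 2 : ℝ) : ℂ) • 1 := by
  rw [displacementHamiltonian_eq, map_add, map_sub, map_smul, map_one, configOp_apply]
  rfl

variable {X}

theorem isSymmetric_toEuclideanCLM {A : Matrix (Fin (n + 1)) (Fin (n + 1)) ℂ}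
    (hA : A.IsHermitian) :
    ((Matrix.toEuclideanCLM (n := Fin (n + 1)) (𝕜 := ℂ) A : Op n) :
      Hilb n →ₗ[ℂ] Hilb n).IsSymmetric :=
  Matrix.isSymmetric_toEuclideanLin_iff.2 hA

theorem isHermitian_displacementHamiltonian (hX : ∀ a, (X a).IsHermitian)
    (x : EuclideanSpace ℝ (Fin D)) : (displacementHamiltonian X x).IsHermitian := by
  have h1 : ∀ a, (X a - (x a : ℂ) • 1).IsHermitian := fun a => by
    refine (hX a).sub ?_
    rw [Matrix.IsHermitian, Matrix.conjTranspose_smul, Matrix.conjTranspose_one]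
    simp
  unfold displacementHamiltonian
  rw [Matrix.IsHermitian, Matrix.conjTranspose_smul, Matrix.conjTranspose_sum]
  simp only [(((h1 _).pow 2)).eq]
  simp

theorem isSymmetric_originOp_sub (hX : ∀ a, (X a).IsHermitian) (x : EuclideanSpace ℝ (Fin D)) :
    ((originOp X - configOp X x : Op n) : Hilb n →ₗ[ℂ] Hilb n).IsSymmetric := by
  have h1 := isSymmetric_toEuclideanCLM (isHermitian_displacementHamiltonian hX x)
  rw [toEuclideanCLM_displacementHamiltonian] at h1
  generalize ‖x‖ ^ 2 / 2 = s at h1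
  intro u v
  have h2 := h1 u v
  have h3 : ∀ u, (originOp X - configOp X x + (s : ℂ) • 1) u
      = (originOp X - configOp X x) u + (s : ℂ) • u := fun u => rfl
  simp only [ContinuousLinearMap.coe_coe, h3, inner_add_left, inner_add_right, inner_smul_left,
    inner_smul_right, Complex.conj_ofReal] at h2
  exact add_right_cancel h2

/-- The scalar `‖x‖² / 2` is absorbed into `c`, which leaves a criterion affine in `x`. -/
theorem mem_regularDomain_and_groundSpace_iff (hX : ∀ a, (X a).IsHermitian)
    {x : EuclideanSpace ℝ (Fin D)} {v : Hilb n} (hv : v ≠ 0) :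
    (x ∈ regularDomain X ∧ groundSpace X x = Submodule.span ℂ {v}) ↔
    ∃ c : ℝ, (originOp X - configOp X x) v = (c : ℂ) • v ∧
      PosForm (originOp X - configOp X x - (c : ℂ) • 1 + ketBra v) := by
  have h1 := simple_ground_iff
    (isSymmetric_toEuclideanCLM (isHermitian_displacementHamiltonian hX x)) hv
  have h2 : (x ∈ regularDomain X ∧ groundSpace X x = Submodule.span ℂ {v}) ↔
      groundSpace X x = Submodule.span ℂ {v} := by
    refine and_iff_right_of_imp fun h => ?_
    change Module.finrank ℂ (groundSpace X x) = 1
    rw [h, finrank_span_singleton hv]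
  rw [h2]
  refine h1.trans ?_
  rw [toEuclideanCLM_displacementHamiltonian]
  set s := ‖x‖ ^ 2 / 2
  set K := originOp X - configOp X x
  constructor
  · rintro ⟨c, hc, hp⟩
    refine ⟨c - s, ?_, ?_⟩
    · rw [Complex.ofReal_sub, sub_smul, ← hc]
      simp
    · convert hp using 2
      ext u : 1
      simp only [add_apply, sub_apply, smul_apply, Complex.ofReal_sub]
      module
  · rintro ⟨c, hc, hp⟩
    refine ⟨c + s, ?_, ?_⟩
    · rw [Complex.ofReal_add, add_smul, ← hc]
      simp
    · convert hp using 2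
      ext u : 1
      simp only [add_apply, sub_apply, smul_apply, Complex.ofReal_add]
      module

end Family

/-! ### The equations of the quasi-coherent states in an affine chart -/

section Chart

variable {n : ℕ}

theorem contDiff_op_apply : ContDiff ℝ ∞ fun p : Op n × Hilb n => p.1 p.2 :=
  (isBoundedBilinearMap_apply (𝕜 := ℂ) (E := Hilb n) (F := Hilb n)).contDiff.restrict_scalars ℝ

/-- The failure of `u` to be proportional to the vector with affine coordinates `w`. -/
def chartResidue (i : Fin (n + 1)) (u : Hilb n) (w : CPModel n) : CPModel n :=
  WithLp.toLp 2 fun j => u (i.succAbove j) - u i * w j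

/-- The tangent vector of `ℂ^(n+1)` with affine coordinates `δ`. -/
def affineTangent (i : Fin (n + 1)) (δ : CPModel n) : Hilb n :=
  WithLp.toLp 2 (i.insertNth (α := fun _ => ℂ) 0 δ.ofLp)

theorem affineTangent_self (i : Fin (n + 1)) (δ : CPModel n) : affineTangent i δ i = 0 := by
  simp [affineTangent]

theorem affineTangent_succAbove (i : Fin (n + 1)) (δ : CPModel n) (j : Fin n) :
    affineTangent i δ (i.succAbove j) = δ j := by
  simp [affineTangent]

theorem affineVec_add_smul (i : Fin (n + 1)) (w δ : CPModel n) (t : ℝ) :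
    affineVec n i (w + t • δ) = affineVec n i w + (t : ℂ) • affineTangent i δ := by
  ext k
  rcases Fin.eq_self_or_eq_succAbove i k with rfl | ⟨j, rfl⟩
  · simp [affineVec_self, affineTangent_self]
  · simp [affineVec_succAbove, affineTangent_succAbove]

theorem chartResidue_eq_zero_iff {i : Fin (n + 1)} {u : Hilb n} {w : CPModel n} :
    chartResidue i u w = 0 ↔ u = u i • affineVec n i w := by
  constructor
  · intro h
    ext k
    rcases Fin.eq_self_or_eq_succAbove i k with rfl | ⟨j, rfl⟩
    · simp [affineVec_self]
    · have := congrArg (fun z : CPModel n => z j) h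
      simp only [chartResidue, PiLp.zero_apply] at this
      simp [affineVec_succAbove, sub_eq_zero.1 this]
  · intro h
    ext j
    have := congrArg (fun z : Hilb n => z (i.succAbove j)) h
    simp only [PiLp.smul_apply, affineVec_succAbove, smul_eq_mul] at this
    simp [chartResidue, this]

theorem chartResidue_sub (i : Fin (n + 1)) (u u' : Hilb n) (w : CPModel n) :
    chartResidue i (u - u') w = chartResidue i u w - chartResidue i u' w := by
  ext j; simp [chartResidue]; ring

theorem contDiff_chartResidue (i : Fin (n + 1)) :
    ContDiff ℝ ∞ fun p : Hilb n × CPModel n => chartResidue i p.1 p.2 := by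
  refine contDiff_piLp' 2 fun j => ?_
  have h1 : ∀ k, ContDiff ℝ ∞ fun p : Hilb n × CPModel n => p.1 k := fun k =>
    (contDiff_piLp_apply (𝕜 := ℝ) (E := fun _ : Fin (n + 1) => ℂ) 2).comp contDiff_fst
  have h2 : ContDiff ℝ ∞ fun p : Hilb n × CPModel n => p.2 j :=
    (contDiff_piLp_apply (𝕜 := ℝ) (E := fun _ : Fin n => ℂ) 2).comp contDiff_snd
  exact (h1 _).sub ((h1 _).mul h2)

end Chart

/-! ### The linear system and the gap condition for a fixed state -/

section Solutions

variable {D n : ℕ} (X : Fin D → Matrix (Fin (n + 1)) (Fin (n + 1)) ℂ) (i : Fin (n + 1))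

/-- The inhomogeneous term of the eigenvector equation in the `i`-th affine chart. -/
def chartConst (w : CPModel n) : CPModel n :=
  chartResidue i (originOp X (affineVec n i w)) w

/-- The linear part of the eigenvector equation in the `i`-th affine chart. -/
def chartLinear (w : CPModel n) : EuclideanSpace ℝ (Fin D) →L[ℝ] CPModel n :=
  LinearMap.toContinuousLinearMap
    { toFun := fun z => chartResidue i (configOp X z (affineVec n i w)) w
      map_add' := fun z z' => by ext j; simp [chartResidue]; ring
      map_smul' := fun r z => by ext j; simp [chartResidue]; ring }

theorem chartLinear_apply (w : CPModel n) (z : EuclideanSpace ℝ (Fin D)) :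
    chartLinear X i w z = chartResidue i (configOp X z (affineVec n i w)) w := rfl

theorem chartConst_sub_chartLinear (w : CPModel n) (z : EuclideanSpace ℝ (Fin D)) :
    chartConst X i w - chartLinear X i w z
      = chartResidue i ((originOp X - configOp X z) (affineVec n i w)) w :=
  (chartResidue_sub _ _ _ _).symm

theorem contDiff_chartConst : ContDiff ℝ ∞ (chartConst X i) :=
  (contDiff_chartResidue i).comp ((contDiff_op_apply.comp
    (contDiff_const.prodMk (contDiff_affineVec n i))).prodMk contDiff_id)

theorem contDiff_chartLinear : ContDiff ℝ ∞ (chartLinear X i) := by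
  rw [contDiff_clm_apply_iff]
  exact fun z => (contDiff_chartResidue i).comp ((contDiff_op_apply.comp
    (contDiff_const.prodMk (contDiff_affineVec n i))).prodMk contDiff_id)

/-- A description of the kernel that involves only the line of the state, for the comparison of
charts. -/
theorem mem_ker_chartLinear_iff {w : CPModel n} {z : EuclideanSpace ℝ (Fin D)} :
    chartLinear X i w z = 0 ↔ ∃ c : ℂ, configOp X z (affineVec n i w) = c • affineVec n i w := by
  rw [chartLinear_apply, chartResidue_eq_zero_iff]
  refine ⟨fun h => ⟨_, h⟩, ?_⟩
  rintro ⟨c, hc⟩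
  rw [hc, PiLp.smul_apply, affineVec_self, smul_eq_mul, mul_one]

/-- The candidate for the eigenvalue in the `i`-th affine chart. -/
def chartEigenvalue (x : EuclideanSpace ℝ (Fin D)) (w : CPModel n) : ℝ :=
  ((originOp X - configOp X x) (affineVec n i w) i).re

/-- The operator whose positivity expresses that the state with affine coordinates `w` is the
unique lowest one. -/
def gapOp (x : EuclideanSpace ℝ (Fin D)) (w : CPModel n) : Op n :=
  originOp X - configOp X x - (chartEigenvalue X i x w : ℂ) • 1 + ketBra (affineVec n i w)

/-- The state with affine coordinates `w` is the quasi-coherent state at `x`. -/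
def IsChartSolution (x : EuclideanSpace ℝ (Fin D)) (w : CPModel n) : Prop :=
  chartLinear X i w x = chartConst X i w ∧ PosForm (gapOp X i x w)

theorem contDiff_gapOp :
    ContDiff ℝ ∞ fun p : EuclideanSpace ℝ (Fin D) × CPModel n => gapOp X i p.1 p.2 := by
  have hK : ContDiff ℝ ∞ fun p : EuclideanSpace ℝ (Fin D) × CPModel n =>
      originOp X - configOp X p.1 := contDiff_const.sub ((configOp X).contDiff.comp contDiff_fst)
  have hv : ContDiff ℝ ∞ fun p : EuclideanSpace ℝ (Fin D) × CPModel n => affineVec n i p.2 :=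
    (contDiff_affineVec n i).comp contDiff_snd
  have hc : ContDiff ℝ ∞ fun p : EuclideanSpace ℝ (Fin D) × CPModel n =>
      chartEigenvalue X i p.1 p.2 :=
    Complex.reCLM.contDiff.comp ((contDiff_piLp_apply (𝕜 := ℝ)
      (E := fun _ : Fin (n + 1) => ℂ) 2).comp (contDiff_op_apply.comp (hK.prodMk hv)))
  have hc' : ContDiff ℝ ∞ fun p : EuclideanSpace ℝ (Fin D) × CPModel n =>
      (chartEigenvalue X i p.1 p.2 : ℂ) • (1 : Op n) := by
    have h := hc.smul (contDiff_const (c := (1 : Op n)))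
    convert! h using 1
  exact (hK.sub hc').add (contDiff_ketBra.comp hv)

/-- For a fixed state the eigenvalue candidate is affine in `x` and the rank one term is constant.
This yields the convexity of the fibres and the ray condition of the trivialization. -/
theorem gapOp_lineMap (x y : EuclideanSpace ℝ (Fin D)) (w : CPModel n) (r : ℝ) :
    gapOp X i (x + r • (y - x)) w
      = gapOp X i x w + r • (gapOp X i y w - gapOp X i x w) := by
  ext u : 1
  simp only [gapOp, chartEigenvalue, map_add, map_smul, map_sub, add_apply, sub_apply, smul_apply,
    PiLp.add_apply, PiLp.sub_apply, PiLp.smul_apply, Complex.add_re, Complex.sub_re,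
    Complex.smul_re, smul_eq_mul, one_apply_eq_self, Complex.coe_smul, ketBra_apply]
  module

variable {X i}

theorem isSymmetric_gapOp (hX : ∀ a, (X a).IsHermitian) (x : EuclideanSpace ℝ (Fin D))
    (w : CPModel n) : (gapOp X i x w : Hilb n →ₗ[ℂ] Hilb n).IsSymmetric :=
  isSymmetric_shift (isSymmetric_originOp_sub hX x) _ _

theorem isChartSolution_iff_groundSpace (hX : ∀ a, (X a).IsHermitian)
    {x : EuclideanSpace ℝ (Fin D)} {w : CPModel n} :
    IsChartSolution X i x w ↔
      x ∈ regularDomain X ∧ groundSpace X x = Submodule.span ℂ {affineVec n i w} := by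
  rw [mem_regularDomain_and_groundSpace_iff hX (affineVec_ne_zero n i w)]
  have h1 : chartLinear X i w x = chartConst X i w ↔ _ :=
    (eq_comm.trans sub_eq_zero.symm).trans
      (by rw [chartConst_sub_chartLinear, chartResidue_eq_zero_iff])
  unfold IsChartSolution
  rw [h1]
  constructor
  · rintro ⟨h, hp⟩
    -- Eigenvalues of a symmetric operator are real, so nothing is lost by the real part in
    -- `chartEigenvalue`.
    have hre : (((originOp X - configOp X x) (affineVec n i w) i).re : ℂ)
        = (originOp X - configOp X x) (affineVec n i w) i := by
      refine Complex.conj_eq_iff_re.1 ((isSymmetric_originOp_sub hX x).conj_eigenvalue_eq_self ?_)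
      exact Module.End.hasEigenvalue_of_hasEigenvector (Module.End.hasEigenvector_iff.2
        ⟨Module.End.mem_eigenspace_iff.2 h, affineVec_ne_zero n i w⟩)
    exact ⟨chartEigenvalue X i x w, by rw [chartEigenvalue, hre]; exact h, hp⟩
  · rintro ⟨c, hc, hp⟩
    have hci : (originOp X - configOp X x) (affineVec n i w) i = c := by
      rw [hc, PiLp.smul_apply, affineVec_self, smul_eq_mul, mul_one]
    refine ⟨by rw [hci]; exact hc, ?_⟩
    rw [gapOp, chartEigenvalue, hci, Complex.ofReal_re]
    exact hp

theorem quantumMap_eq_mk_iff {x : EuclideanSpace ℝ (Fin D)} (hx : x ∈ regularDomain X)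
    {v : Hilb n} (hv : v ≠ 0) :
    quantumMap X x = Projectivization.mk ℂ v hv ↔ groundSpace X x = Submodule.span ℂ {v} := by
  have hx' : Module.finrank ℂ (groundSpace X x) = 1 := hx
  rw [quantumMap, dif_pos hx', ← Projectivization.submodule_injective.eq_iff,
    Projectivization.submodule_mk'', Projectivization.submodule_mk]

theorem quantumMap_eq_iff {x y : EuclideanSpace ℝ (Fin D)} (hx : x ∈ regularDomain X)
    (hy : y ∈ regularDomain X) :
    quantumMap X x = quantumMap X y ↔ groundSpace X x = groundSpace X y := by
  have hx' : Module.finrank ℂ (groundSpace X x) = 1 := hx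
  have hy' : Module.finrank ℂ (groundSpace X y) = 1 := hy
  rw [quantumMap, dif_pos hx', quantumMap, dif_pos hy', ← Projectivization.submodule_injective.eq_iff,
    Projectivization.submodule_mk'', Projectivization.submodule_mk'']

theorem isChartSolution_iff (hX : ∀ a, (X a).IsHermitian)
    {x : EuclideanSpace ℝ (Fin D)} {w : CPModel n} :
    IsChartSolution X i x w ↔
      x ∈ regularDomain X ∧ quantumMap X x = (affineChart n i).symm w := by
  rw [isChartSolution_iff_groundSpace hX]
  exact and_congr_right fun hx => (quantumMap_eq_mk_iff hx (affineVec_ne_zero n i w)).symm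

theorem IsChartSolution.affineCoord_eq (hX : ∀ a, (X a).IsHermitian)
    {x : EuclideanSpace ℝ (Fin D)} {w : CPModel n} (h : IsChartSolution X i x w) :
    affineCoord n i (quantumMap X x) = w := by
  rw [((isChartSolution_iff hX).1 h).2]
  exact (affineChart n i).right_inv (Set.mem_univ w)

theorem isChartSolution_affineCoord (hX : ∀ a, (X a).IsHermitian)
    {x : EuclideanSpace ℝ (Fin D)} (hx : x ∈ regularDomain X)
    (hi : quantumMap X x ∈ affineSource n i) :
    IsChartSolution X i x (affineCoord n i (quantumMap X x)) :=
  (isChartSolution_iff hX).2 ⟨hx, ((affineChart n i).left_inv hi).symm⟩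

theorem equivClass_eq (hX : ∀ a, (X a).IsHermitian)
    {x : EuclideanSpace ℝ (Fin D)} {w : CPModel n} (h : IsChartSolution X i x w) :
    equivClass X x = {y | IsChartSolution X i y w} := by
  ext y
  have hx := (isChartSolution_iff_groundSpace hX).1 h
  change (y ∈ regularDomain X ∧ groundSpace X y = groundSpace X x) ↔ IsChartSolution X i y w
  rw [isChartSolution_iff_groundSpace hX, hx.2]

theorem IsChartSolution.mem_regularDomain (hX : ∀ a, (X a).IsHermitian)
    {x : EuclideanSpace ℝ (Fin D)} {w : CPModel n} (h : IsChartSolution X i x w) :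
    x ∈ regularDomain X :=
  ((isChartSolution_iff hX).1 h).1

/-! ### The smooth dependence of the quasi-coherent states on the point -/

/-- The linearized eigenvector equation reads `K δ' = a δ' + b v` with `δ'` the tangent vector.
Pairing with `v` gives `b = 0`, the gap makes `δ'` a multiple of `v`, and its `i`-th entry is `0`
while that of `v` is `1`. -/
theorem residue_derivative_injective (hX : ∀ a, (X a).IsHermitian)
    {x : EuclideanSpace ℝ (Fin D)} {w : CPModel n} (h : IsChartSolution X i x w) {δ : CPModel n}
    (hδ : chartResidue i ((originOp X - configOp X x) (affineTangent i δ)) w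
      = (originOp X - configOp X x) (affineVec n i w) i • δ) : δ = 0 := by
  set K := originOp X - configOp X x
  set v := affineVec n i w
  set a := K v i
  set b := K (affineTangent i δ) i
  have hKv : K v = a • v := by
    rw [← chartResidue_eq_zero_iff, ← chartConst_sub_chartLinear, h.1, sub_self]
  have hKδ : K (affineTangent i δ) = a • affineTangent i δ + b • v := by
    ext k
    rcases Fin.eq_self_or_eq_succAbove i k with rfl | ⟨j, rfl⟩
    · simp [affineTangent_self, v, affineVec_self, b]
    · have := congrArg (fun z : CPModel n => z j) hδ
      simp only [chartResidue, PiLp.smul_apply, smul_eq_mul] at this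
      simp only [PiLp.add_apply, PiLp.smul_apply, affineTangent_succAbove, v, affineVec_succAbove,
        smul_eq_mul, ← this, b]
      ring
  have hvv : ⟪v, v⟫_ℂ ≠ 0 := inner_self_ne_zero.2 (affineVec_ne_zero n i w)
  have hsym := isSymmetric_originOp_sub hX x
  have hconj : (starRingEnd ℂ) a = a :=
    hsym.conj_eigenvalue_eq_self
      (Module.End.hasEigenvalue_of_hasEigenvector (Module.End.hasEigenvector_iff.2
        ⟨Module.End.mem_eigenspace_iff.2 hKv, affineVec_ne_zero n i w⟩))
  have hb : b = 0 := by
    have h1 : ⟪K v, affineTangent i δ⟫_ℂ = ⟪v, K (affineTangent i δ)⟫_ℂ := hsym _ _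
    rw [hKv, hKδ, inner_smul_left, hconj, inner_add_right, inner_smul_right, inner_smul_right] at h1
    exact (mul_eq_zero.1 (left_eq_add.1 h1)).resolve_right hvv
  have hac : (chartEigenvalue X i x w : ℂ) = a := Complex.conj_eq_iff_re.1 hconj
  set s := ⟪v, affineTangent i δ⟫_ℂ / ⟪v, v⟫_ℂ with hs
  have hu : affineTangent i δ - s • v = 0 := by
    by_contra hne
    have h1 := h.2 _ hne
    have h2 : ⟪v, affineTangent i δ - s • v⟫_ℂ = 0 := by
      rw [inner_sub_right, inner_smul_right, hs, div_mul_cancel₀ _ hvv, sub_self]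
    have h3 : gapOp X i x w (affineTangent i δ - s • v) = 0 := by
      change K (affineTangent i δ - s • v) - (chartEigenvalue X i x w : ℂ) •
        (affineTangent i δ - s • v) + ⟪v, affineTangent i δ - s • v⟫_ℂ • v = 0
      rw [h2, hac, map_sub, map_smul, hKv, hKδ, hb]
      module
    rw [h3] at h1
    simp at h1
  have hs0 : s = 0 := by
    have := congrArg (fun z : Hilb n => z i) hu
    simpa [affineTangent_self, v, affineVec_self] using this
  rw [hs0, zero_smul, sub_zero] at hu
  ext j
  rw [← affineTangent_succAbove i δ j, hu]
  rfl

/-- The map whose zeros are the solutions of the eigenvector equation. -/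
def chartEquation (X : Fin D → Matrix (Fin (n + 1)) (Fin (n + 1)) ℂ) (i : Fin (n + 1))
    (p : EuclideanSpace ℝ (Fin D) × CPModel n) : CPModel n :=
  chartConst X i p.2 - chartLinear X i p.2 p.1

theorem contDiff_chartEquation : ContDiff ℝ ∞ (chartEquation X i) :=
  ((contDiff_chartConst X i).comp contDiff_snd).sub
    (((contDiff_chartLinear X i).comp contDiff_snd).clm_apply contDiff_fst)

theorem hasFDerivAt_chartEquation (p : EuclideanSpace ℝ (Fin D) × CPModel n) :
    HasFDerivAt (chartEquation X i) (fderiv ℝ (chartEquation X i) p) p :=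
  (contDiff_chartEquation.differentiable (by simp) _).hasFDerivAt

theorem fderiv_chartEquation_left (x₀ : EuclideanSpace ℝ (Fin D)) (w₀ : CPModel n)
    (a : EuclideanSpace ℝ (Fin D)) :
    fderiv ℝ (chartEquation X i) (x₀, w₀) (a, 0) = - chartLinear X i w₀ a := by
  have h1 := HasFDerivAt.comp (g := chartEquation X i) (f := fun x => (x, w₀)) x₀
    (hasFDerivAt_chartEquation (x₀, w₀)) (hasFDerivAt_prodMk_left x₀ w₀)
  have h2 : HasFDerivAt (fun x => chartEquation X i (x, w₀)) (-chartLinear X i w₀) x₀ :=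
    (chartLinear X i w₀).hasFDerivAt.const_sub (chartConst X i w₀)
  exact DFunLike.congr_fun (h1.unique h2) a

/-- The equation is exactly quadratic along a line of states, so its derivative is the coefficient
of `t`. -/
theorem chartEquation_add_smul (x₀ : EuclideanSpace ℝ (Fin D)) (w₀ δ : CPModel n) (t : ℝ) :
    chartEquation X i (x₀, w₀ + t • δ) = chartEquation X i (x₀, w₀)
      + t • (chartResidue i ((originOp X - configOp X x₀) (affineTangent i δ)) w₀
          - (originOp X - configOp X x₀) (affineVec n i w₀) i • δ)
      - (t * t) • ((originOp X - configOp X x₀) (affineTangent i δ) i • δ) := by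
  simp only [chartEquation, chartConst_sub_chartLinear, affineVec_add_smul]
  rw [map_add, map_smul]
  generalize (originOp X - configOp X x₀) (affineTangent i δ) = u
  generalize (originOp X - configOp X x₀) (affineVec n i w₀) = u'
  ext j
  simp [chartResidue]
  ring

theorem fderiv_chartEquation_right_injective (hX : ∀ a, (X a).IsHermitian)
    {x₀ : EuclideanSpace ℝ (Fin D)} {w₀ : CPModel n} (h : IsChartSolution X i x₀ w₀)
    {δ : CPModel n} (hδ : fderiv ℝ (chartEquation X i) (x₀, w₀) (0, δ) = 0) : δ = 0 := by
  refine residue_derivative_injective hX h (sub_eq_zero.1 ?_)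
  have hc : HasDerivAt (fun t : ℝ => (x₀, w₀ + t • δ)) ((0 : EuclideanSpace ℝ (Fin D)), δ) 0 := by
    have h1 : HasDerivAt (fun t : ℝ => w₀ + t • δ) ((1 : ℝ) • δ) 0 :=
      ((hasDerivAt_id (0 : ℝ)).smul_const δ).const_add w₀
    rw [one_smul] at h1
    exact (hasDerivAt_const (0 : ℝ) x₀).prodMk h1
  have h1 : HasDerivAt (fun t : ℝ => chartEquation X i (x₀, w₀ + t • δ))
      (fderiv ℝ (chartEquation X i) (x₀, w₀) (0, δ)) 0 :=
    HasFDerivAt.comp_hasDerivAt (l := chartEquation X i) (0 : ℝ)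
      (by rw [zero_smul, add_zero]; exact hasFDerivAt_chartEquation _) hc
  rw [hδ] at h1
  refine HasDerivAt.unique ?_ h1
  simp only [chartEquation_add_smul]
  generalize chartResidue i ((originOp X - configOp X x₀) (affineTangent i δ)) w₀
    - (originOp X - configOp X x₀) (affineVec n i w₀) i • δ = M
  generalize (originOp X - configOp X x₀) (affineTangent i δ) i • δ = N
  generalize chartEquation X i (x₀, w₀) = N'
  have e1 : HasDerivAt (fun t : ℝ => t • M) ((1 : ℝ) • M) 0 :=
    (hasDerivAt_id (0 : ℝ)).smul_const M
  have e2 : HasDerivAt (fun t : ℝ => (t * t) • N) (((1 : ℝ) * 0 + 0 * 1) • N) 0 :=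
    ((hasDerivAt_id (0 : ℝ)).mul (hasDerivAt_id (0 : ℝ))).smul_const N
  refine ((e1.const_add N').sub e2).congr_deriv ?_
  simp

theorem exists_chartEquation_equiv (hX : ∀ a, (X a).IsHermitian)
    {x₀ : EuclideanSpace ℝ (Fin D)} {w₀ : CPModel n} (h : IsChartSolution X i x₀ w₀) :
    ∃ e : (EuclideanSpace ℝ (Fin D) × CPModel n) ≃L[ℝ] (EuclideanSpace ℝ (Fin D) × CPModel n),
      HasFDerivAt (fun p => (p.1, chartEquation X i p))
        (e : (EuclideanSpace ℝ (Fin D) × CPModel n) →L[ℝ] (EuclideanSpace ℝ (Fin D) × CPModel n))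
        (x₀, w₀) := by
  obtain ⟨e, he⟩ := exists_equiv_of_injective
    ((ContinuousLinearMap.fst ℝ (EuclideanSpace ℝ (Fin D)) (CPModel n)).prod
      (fderiv ℝ (chartEquation X i) (x₀, w₀))) (by
      rintro ⟨a, δ⟩ hv
      obtain ⟨ha, hδ⟩ := Prod.mk_eq_zero.1 hv
      have ha' : a = 0 := ha
      subst ha'
      rw [fderiv_chartEquation_right_injective hX h hδ]
      rfl)
  exact ⟨e, he ▸ hasFDerivAt_fst.prodMk (hasFDerivAt_chartEquation (x₀, w₀))⟩

/-- Implicit differentiation: `-T a + ∂_w F (g' a) = 0`, with `T` the linear part at `g x₀`, and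
`∂_w F` is injective. -/
theorem fderiv_solution_eq_zero_iff (hX : ∀ a, (X a).IsHermitian)
    {x₀ : EuclideanSpace ℝ (Fin D)} {g : EuclideanSpace ℝ (Fin D) → CPModel n}
    {g' : EuclideanSpace ℝ (Fin D) →L[ℝ] CPModel n} (h : IsChartSolution X i x₀ (g x₀))
    (hg : HasFDerivAt g g' x₀) (hFg : ∀ᶠ x in nhds x₀, chartEquation X i (x, g x) = 0)
    (a : EuclideanSpace ℝ (Fin D)) : g' a = 0 ↔ chartLinear X i (g x₀) a = 0 := by
  set L := fderiv ℝ (chartEquation X i) (x₀, g x₀) with hL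
  have h1 := HasFDerivAt.comp (g := chartEquation X i) x₀
    (hasFDerivAt_chartEquation (x₀, g x₀)) ((hasFDerivAt_id x₀).prodMk hg)
  have h2 : HasFDerivAt (fun x => chartEquation X i (x, g x))
      (0 : EuclideanSpace ℝ (Fin D) →L[ℝ] CPModel n) x₀ :=
    (hasFDerivAt_const 0 x₀).congr_of_eventuallyEq hFg
  have h3 : L (a, g' a) = 0 := DFunLike.congr_fun (h1.unique h2) a
  have h4 : L (a, g' a) = L (a, 0) + L (0, g' a) := by
    rw [← map_add, Prod.mk_add_mk, add_zero, zero_add]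
  rw [h4, hL, fderiv_chartEquation_left] at h3
  constructor
  · intro h5
    rw [h5, ← Prod.zero_eq_mk, map_zero, add_zero, neg_eq_zero] at h3
    exact h3
  · intro h5
    rw [h5, neg_zero, zero_add] at h3
    exact fderiv_chartEquation_right_injective hX h h3

/-- The local smooth solution of the eigenvector equation. -/
theorem exists_local_solution (hX : ∀ a, (X a).IsHermitian)
    {x₀ : EuclideanSpace ℝ (Fin D)} {w₀ : CPModel n} (h : IsChartSolution X i x₀ w₀) :
    ∃ (U : Set (EuclideanSpace ℝ (Fin D))) (g : EuclideanSpace ℝ (Fin D) → CPModel n),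
      IsOpen U ∧ x₀ ∈ U ∧ ContDiffOn ℝ ∞ g U ∧ g x₀ = w₀ ∧ (∀ x ∈ U, IsChartSolution X i x (g x)) ∧
      ∀ a, fderiv ℝ g x₀ a = 0 ↔ chartLinear X i w₀ a = 0 := by
  set Φ : EuclideanSpace ℝ (Fin D) × CPModel n → EuclideanSpace ℝ (Fin D) × CPModel n :=
    fun p => (p.1, chartEquation X i p)
  have hΦc : ContDiff ℝ ∞ Φ := contDiff_fst.prodMk contDiff_chartEquation
  obtain ⟨e', he'⟩ := exists_chartEquation_equiv hX h
  obtain ⟨e, he, hmem, -, hes⟩ := exists_smooth_openPartialHomeomorph isOpen_univ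
    hΦc.contDiffOn (Set.mem_univ _) he'
  set g : EuclideanSpace ℝ (Fin D) → CPModel n := fun x => (e.symm (x, 0)).2 with hg
  set U₁ : Set (EuclideanSpace ℝ (Fin D)) := (fun x => (x, (0 : CPModel n))) ⁻¹' e.target
  have hU₁ : IsOpen U₁ := e.open_target.preimage (by fun_prop)
  have hex₀ : e (x₀, w₀) = (x₀, 0) := by rw [he]; exact Prod.ext rfl (sub_eq_zero.2 h.1.symm)
  have hx₀ : x₀ ∈ U₁ := by
    change (x₀, (0 : CPModel n)) ∈ e.target
    rw [← hex₀]
    exact e.map_source hmem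
  have hgc : ContDiffOn ℝ ∞ g U₁ := contDiff_snd.comp_contDiffOn
    (hes.comp (contDiff_id.prodMk contDiff_const).contDiffOn fun x hx => hx)
  have hgx₀ : g x₀ = w₀ := by
    simp only [hg, ← hex₀, e.left_inv hmem]
  have hFg : ∀ x ∈ U₁, chartEquation X i (x, g x) = 0 := by
    intro x hx
    have h1 : Φ (e.symm (x, 0)) = (x, 0) := by rw [← he]; exact e.right_inv hx
    obtain ⟨h2, h3⟩ := Prod.mk.inj h1
    have h4 : e.symm (x, 0) = (x, g x) := Prod.ext h2 rfl
    rw [← h4]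
    exact h3
  have hGc : ContinuousOn (fun x => gapOp X i x (g x)) U₁ :=
    ((contDiff_gapOp X i).comp_contDiffOn (f := fun x => (x, g x))
      (contDiffOn_id.prodMk hgc)).continuousOn
  -- Solving the equation gives only eigenvectors; the open gap condition keeps them lowest and
  -- simple.
  set U := U₁ ∩ (fun x => gapOp X i x (g x)) ⁻¹' {G | PosForm G}
  refine ⟨U, g, hGc.isOpen_inter_preimage hU₁ isOpen_posForm, ⟨hx₀, ?_⟩,
    hgc.mono Set.inter_subset_left, hgx₀, ?_, ?_⟩
  · change PosForm (gapOp X i x₀ (g x₀))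
    rw [hgx₀]
    exact h.2
  · exact fun x hx => ⟨(sub_eq_zero.1 (hFg x hx.1)).symm, hx.2⟩
  · intro a
    have hgd : HasFDerivAt g (fderiv ℝ g x₀) x₀ :=
      ((hgc.contDiffAt (hU₁.mem_nhds hx₀)).differentiableAt (by simp)).hasFDerivAt
    exact fderiv_solution_eq_zero_iff hX (hgx₀ ▸ h) hgd
      (Filter.eventually_of_mem (hU₁.mem_nhds hx₀) hFg) a |>.trans (by rw [hgx₀])

end Solutions

section QuantumMap

variable {D n : ℕ} {X : Fin D → Matrix (Fin (n + 1)) (Fin (n + 1)) ℂ} {i : Fin (n + 1)}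

/-! ### Smoothness and rank of the quantum map -/

theorem affineChart_mem_maximalAtlas (i : Fin (n + 1)) :
    affineChart n i ∈ IsManifold.maximalAtlas 𝓘(ℝ, CPModel n) ∞ (CP n) :=
  IsManifold.subset_maximalAtlas (Set.mem_range_self i)

theorem isOpen_regularDomain (hX : ∀ a, (X a).IsHermitian) : IsOpen (regularDomain X) := by
  rw [isOpen_iff_mem_nhds]
  intro x hx
  obtain ⟨i, hi⟩ := exists_mem_affineSource n (quantumMap X x)
  obtain ⟨U, g, hU, hxU, -, -, hg, -⟩ :=
    exists_local_solution hX (isChartSolution_affineCoord hX hx hi)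
  exact Filter.mem_of_superset (hU.mem_nhds hxU) fun y hy => (hg y hy).mem_regularDomain hX

theorem contDiffOn_affineCoord_quantumMap (hX : ∀ a, (X a).IsHermitian) (i : Fin (n + 1)) :
    ContDiffOn ℝ ∞ (fun x => affineCoord n i (quantumMap X x))
      (regularDomain X ∩ quantumMap X ⁻¹' affineSource n i) := by
  intro x hx
  obtain ⟨U, g, hU, hxU, hgc, -, hg, -⟩ :=
    exists_local_solution hX (isChartSolution_affineCoord hX hx.1 hx.2)
  refine ((hgc.contDiffAt (hU.mem_nhds hxU)).congr_of_eventuallyEq ?_).contDiffWithinAt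
  filter_upwards [hU.mem_nhds hxU] with y hy
  exact (hg y hy).affineCoord_eq hX

theorem contMDiffOn_quantumMap (hX : ∀ a, (X a).IsHermitian) :
    ContMDiffOn 𝓘(ℝ, EuclideanSpace ℝ (Fin D)) 𝓘(ℝ, CPModel n) ∞ (quantumMap X)
      (regularDomain X) := by
  intro x hx
  obtain ⟨i, hi⟩ := exists_mem_affineSource n (quantumMap X x)
  obtain ⟨U, g, hU, hxU, hgc, -, hg, -⟩ :=
    exists_local_solution hX (isChartSolution_affineCoord hX hx hi)
  have h1 : ContMDiffAt 𝓘(ℝ, CPModel n) 𝓘(ℝ, CPModel n) ∞ (affineChart n i).symm (g x) :=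
    contMDiffAt_symm_of_mem_maximalAtlas (affineChart_mem_maximalAtlas i) (Set.mem_univ _)
  have h2 : ContMDiffAt 𝓘(ℝ, EuclideanSpace ℝ (Fin D)) 𝓘(ℝ, CPModel n) ∞ g x :=
    (hgc.contDiffAt (hU.mem_nhds hxU)).contMDiffAt
  refine ((h1.comp x h2).congr_of_eventuallyEq ?_).contMDiffWithinAt
  filter_upwards [hU.mem_nhds hxU] with y hy
  exact ((isChartSolution_iff hX).1 (hg y hy)).2

theorem fderiv_affineCoord_quantumMap_eq_zero_iff (hX : ∀ a, (X a).IsHermitian)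
    {x : EuclideanSpace ℝ (Fin D)} {w : CPModel n} (h : IsChartSolution X i x w)
    (a : EuclideanSpace ℝ (Fin D)) :
    fderiv ℝ (fun x => affineCoord n i (quantumMap X x)) x a = 0 ↔ chartLinear X i w a = 0 := by
  obtain ⟨U, g, hU, hxU, hgc, -, hg, hker⟩ := exists_local_solution hX h
  have : (fun x => affineCoord n i (quantumMap X x)) =ᶠ[nhds x] g := by
    filter_upwards [hU.mem_nhds hxU] with y hy
    exact (hg y hy).affineCoord_eq hX
  rw [this.fderiv_eq, hker]

theorem rankDq_eq (hX : ∀ a, (X a).IsHermitian) {x : EuclideanSpace ℝ (Fin D)}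
    (hx : x ∈ regularDomain X) : ∃ i, quantumMap X x ∈ affineSource n i ∧
      rankDq X x = Module.finrank ℝ (LinearMap.range
        (fderiv ℝ (fun x => affineCoord n i (quantumMap X x)) x).toLinearMap) := by
  -- This is the index that `chartAt` selects, and `mfderiv` is written in that chart.
  refine ⟨(exists_mem_affineSource n (quantumMap X x)).choose,
    (exists_mem_affineSource n (quantumMap X x)).choose_spec, ?_⟩
  have hmd : MDifferentiableAt 𝓘(ℝ, EuclideanSpace ℝ (Fin D)) 𝓘(ℝ, CPModel n)
      (quantumMap X) x := ((contMDiffOn_quantumMap hX).contMDiffAt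
        ((isOpen_regularDomain hX).mem_nhds hx)).mdifferentiableAt (by simp)
  have hd : ∀ f : EuclideanSpace ℝ (Fin D) → CPModel n,
      fderivWithin ℝ f (Set.range 𝓘(ℝ, EuclideanSpace ℝ (Fin D))) x = fderiv ℝ f x := fun f => by
    rw [modelWithCornersSelf_coe, Set.range_id, fderivWithin_univ]
  unfold rankDq
  rw [mfderivWithin_of_isOpen (isOpen_regularDomain hX) hx, hmd.mfderiv]
  exact congrArg (fun L : EuclideanSpace ℝ (Fin D) →L[ℝ] CPModel n =>
    Module.finrank ℝ (LinearMap.range L.toLinearMap)) (hd _)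

theorem IsChartSolution.ker_eq {j : Fin (n + 1)} (hX : ∀ a, (X a).IsHermitian)
    {x : EuclideanSpace ℝ (Fin D)} {w w' : CPModel n} (h : IsChartSolution X i x w)
    (h' : IsChartSolution X j x w') :
    LinearMap.ker (chartLinear X i w).toLinearMap
      = LinearMap.ker (chartLinear X j w').toLinearMap := by
  have h1 := ((isChartSolution_iff_groundSpace hX).1 h).2
  rw [((isChartSolution_iff_groundSpace hX).1 h').2] at h1
  have h2 : affineVec n j w' ∈ Submodule.span ℂ {affineVec n i w} :=
    h1 ▸ Submodule.mem_span_singleton_self _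
  obtain ⟨a, ha⟩ := Submodule.mem_span_singleton.1 h2
  have ha0 : a ≠ 0 := by
    rintro rfl
    rw [zero_smul] at ha
    exact affineVec_ne_zero n j w' ha.symm
  ext z
  change chartLinear X i w z = 0 ↔ chartLinear X j w' z = 0
  rw [mem_ker_chartLinear_iff, mem_ker_chartLinear_iff, ← ha]
  refine exists_congr fun c => ?_
  rw [map_smul, smul_comm c a, (smul_right_injective _ ha0).eq_iff]

theorem IsChartSolution.rankDq_add_finrank_ker (hX : ∀ a, (X a).IsHermitian)
    {x : EuclideanSpace ℝ (Fin D)} {w : CPModel n} (h : IsChartSolution X i x w) :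
    rankDq X x + Module.finrank ℝ (LinearMap.ker (chartLinear X i w).toLinearMap) = D := by
  obtain ⟨j, hj, hr⟩ := rankDq_eq hX (h.mem_regularDomain hX)
  have h' := isChartSolution_affineCoord hX (h.mem_regularDomain hX) hj
  set f := fun x => affineCoord n j (quantumMap X x)
  have hk : LinearMap.ker (chartLinear X i w).toLinearMap
      = LinearMap.ker (fderiv ℝ f x).toLinearMap := by
    rw [h.ker_eq hX h']
    ext z
    exact (fderiv_affineCoord_quantumMap_eq_zero_iff hX h' z).symm
  rw [hr, hk, LinearMap.finrank_range_add_finrank_ker, finrank_euclideanSpace_fin]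

/-! ### The equivalence classes -/

/-- With the state fixed, the linear system cuts out the affine subspace, and positivity of the
affine family `gapOp` cuts out a convex open part. -/
theorem equivClass_convex_and_affine (hX : ∀ a, (X a).IsHermitian)
    {x : EuclideanSpace ℝ (Fin D)} (hx : x ∈ regularDomain X) :
    Convex ℝ (equivClass X x) ∧
      ∃ (L : AffineSubspace ℝ (EuclideanSpace ℝ (Fin D))) (U : Set (EuclideanSpace ℝ (Fin D))),
        Module.finrank ℝ L.direction + rankDq X x = D ∧ IsOpen U ∧
          equivClass X x = (L : Set (EuclideanSpace ℝ (Fin D))) ∩ U := by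
  obtain ⟨i, hi⟩ := exists_mem_affineSource n (quantumMap X x)
  have h := isChartSolution_affineCoord hX hx hi
  set w := affineCoord n i (quantumMap X x)
  rw [equivClass_eq hX h]
  constructor
  · rw [convex_iff_add_mem]
    intro y hy z hz a b ha hb hab
    have hyz : a • y + b • z = y + b • (z - y) := by
      rw [← eq_sub_iff_add_eq] at hab
      rw [hab]; module
    refine ⟨?_, ?_⟩
    · rw [map_add, map_smul, map_smul, hy.1, hz.1, ← add_smul, hab, one_smul]
    · rw [hyz, gapOp_lineMap]
      refine hy.2.segment hb (by linarith) (ρ' := 1) ?_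
      rw [← gapOp_lineMap, one_smul, add_sub_cancel]
      exact hz.2
  · refine ⟨AffineSubspace.mk' x (LinearMap.ker (chartLinear X i w).toLinearMap),
      (fun y => gapOp X i y w) ⁻¹' {G | PosForm G}, ?_, ?_, ?_⟩
    · rw [AffineSubspace.direction_mk', add_comm]
      exact h.rankDq_add_finrank_ker hX
    · exact isOpen_posForm.preimage (((contDiff_gapOp X i).comp
        (f := fun y => (y, w)) (contDiff_id.prodMk contDiff_const)).continuous)
    · ext y
      refine and_congr_left fun _ => ?_
      rw [SetLike.mem_coe, AffineSubspace.mem_mk', LinearMap.mem_ker]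
      change _ ↔ chartLinear X i w (y - x) = 0
      rw [map_sub, h.1, sub_eq_zero]

theorem quantumMap_eq_iff_mem_equivClass {x y : EuclideanSpace ℝ (Fin D)}
    (hx : x ∈ regularDomain X) (hy : y ∈ regularDomain X) :
    quantumMap X x = quantumMap X y ↔ y ∈ equivClass X x := by
  rw [quantumMap_eq_iff hx hy, eq_comm]
  exact (and_iff_right hy).symm

/-! ### Local parametrizations of the equivalence classes -/

/-- Near `w₀` the operator `Θ w = Q T_w + ι ρ` is invertible, and `S (w, t) = (Θ w)⁻¹ (Q b_w + ι
t)`, where `T_w x = b_w` is the linear system at `w`. This is defined and smooth even where the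
system has no solution; for a realized state `w` it runs through all solutions, with `t` as the `ρ`
coordinate. -/
theorem exists_affine_parametrization (hX : ∀ a, (X a).IsHermitian) {m : ℕ}
    (hm : ∀ x ∈ regularDomain X, rankDq X x = m) {x₀ : EuclideanSpace ℝ (Fin D)} {w₀ : CPModel n}
    (h : IsChartSolution X i x₀ w₀) :
    ∃ (O : Set (CPModel n))
      (S : CPModel n × EuclideanSpace ℝ (Fin (D - m)) → EuclideanSpace ℝ (Fin D))
      (ρ : EuclideanSpace ℝ (Fin D) →L[ℝ] EuclideanSpace ℝ (Fin (D - m))),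
      IsOpen O ∧ w₀ ∈ O ∧ ContDiffOn ℝ ∞ S (O ×ˢ Set.univ) ∧
      (∀ w t t' (r : ℝ), S (w, t + r • (t' - t)) = S (w, t) + r • (S (w, t') - S (w, t))) ∧
      (∀ w ∈ O, (∃ x, IsChartSolution X i x w) → ∀ t,
        chartLinear X i w (S (w, t)) = chartConst X i w ∧ ρ (S (w, t)) = t) ∧
      ∀ w ∈ O, ∀ z, chartLinear X i w z = chartConst X i w → S (w, ρ z) = z := by
  have hker : ∀ {x w}, IsChartSolution X i x w →
      Module.finrank ℝ (LinearMap.ker (chartLinear X i w).toLinearMap) = D - m := by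
    intro x w h
    have h1 := h.rankDq_add_finrank_ker hX
    rw [hm x (h.mem_regularDomain hX)] at h1
    omega
  obtain ⟨Q, ι, ρ, hρι, hρQ, hQ⟩ := exists_splitting (chartLinear X i w₀) (hker h)
  set Θ : CPModel n → (EuclideanSpace ℝ (Fin D) →L[ℝ] EuclideanSpace ℝ (Fin D)) :=
    fun w => Q.comp (chartLinear X i w) + ι.comp ρ with hΘ
  have hΘc : ContDiff ℝ ∞ Θ :=
    (contDiff_const.clm_comp (contDiff_chartLinear X i)).add contDiff_const
  have hΘ₀ : Θ w₀ = 1 := by ext1 z; exact hQ z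
  have hleft : ∀ w, IsUnit (Θ w) → ∀ z, Ring.inverse (Θ w) (Θ w z) = z := fun w hw z =>
    DFunLike.congr_fun (Ring.inverse_mul_cancel _ hw) z
  have hright : ∀ w, IsUnit (Θ w) → ∀ z, Θ w (Ring.inverse (Θ w) z) = z := fun w hw z =>
    DFunLike.congr_fun (Ring.mul_inverse_cancel _ hw) z
  refine ⟨{w | IsUnit (Θ w)}, fun p => Ring.inverse (Θ p.1) (Q (chartConst X i p.1) + ι p.2), ρ,
    Units.isOpen.preimage hΘc.continuous, ?_, ?_, ?_, ?_, ?_⟩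
  · change IsUnit (Θ w₀)
    rw [hΘ₀]
    exact isUnit_one
  · have hinv : ContDiffOn ℝ ∞ (fun w => Ring.inverse (Θ w)) {w | IsUnit (Θ w)} := by
      rintro w ⟨u, hu⟩
      have h1 : ContDiffAt ℝ ∞ Ring.inverse (Θ w) := hu ▸ contDiffAt_ringInverse ℝ u
      exact (h1.comp w hΘc.contDiffAt).contDiffWithinAt
    refine (hinv.comp contDiffOn_fst fun p hp => hp.1).clm_apply (ContDiff.contDiffOn ?_)
    exact (Q.contDiff.comp ((contDiff_chartConst X i).comp contDiff_fst)).add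
      (ι.contDiff.comp contDiff_snd)
  · intro w t t' r
    simp only [map_add, map_smul, map_sub]
    module
  · rintro w hw ⟨x, hx⟩ t
    set z := Ring.inverse (Θ w) (Q (chartConst X i w) + ι t) with hz
    have h1 : Q (chartLinear X i w z) + ι (ρ z) = Q (chartConst X i w) + ι t := hright w hw _
    have h2 : ρ z = t := by
      have := congrArg ρ h1
      simpa only [map_add, hρQ, hρι, zero_add] using this
    refine ⟨?_, h2⟩
    rw [h2] at h1
    -- So far the system holds only after applying `Q`. Since the kernels at `w` and `w₀` have the
    -- same dimension, `eq_zero_of_splitting` removes `Q`.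
    have h3 : Q (chartLinear X i w (z - x)) = 0 := by
      rw [map_sub, map_sub, hx.1, add_right_cancel h1, sub_self]
    have h4 := eq_zero_of_splitting (T := chartLinear X i w) (ι := ι) (ρ := ρ) (Q := Q)
      (fun y hy => by
        have hy' : Θ w y = 0 := hy
        rw [← hleft w hw y, hy', map_zero]) (hker hx) h3
    rw [map_sub, sub_eq_zero, hx.1] at h4
    exact h4
  · intro w hw z hz
    simp only
    rw [← hz]
    exact hleft w hw z

/-- Through every point of the regular domain passes a smooth local section over the abstract
quantum space, which extends to an open set of states. -/
theorem exists_section (hX : ∀ a, (X a).IsHermitian) {m : ℕ}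
    (hm : ∀ x ∈ regularDomain X, rankDq X x = m) {x₀ : EuclideanSpace ℝ (Fin D)} {w₀ : CPModel n}
    (h : IsChartSolution X i x₀ w₀) {N : Set (EuclideanSpace ℝ (Fin D))} (hN : IsOpen N)
    (hxN : x₀ ∈ N) :
    ∃ (O : Set (CPModel n)) (s : CPModel n → EuclideanSpace ℝ (Fin D)),
      IsOpen O ∧ w₀ ∈ O ∧ ContDiffOn ℝ ∞ s O ∧ s w₀ = x₀ ∧ (∀ w ∈ O, s w ∈ N) ∧
      ∀ w ∈ O, (∃ x, IsChartSolution X i x w) → IsChartSolution X i (s w) w := by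
  obtain ⟨O, S, ρ, hO, hwO, hS, -, hS1, hS2⟩ := exists_affine_parametrization hX hm h
  -- The section keeps the kernel coordinate of `x₀` fixed.
  set s : CPModel n → EuclideanSpace ℝ (Fin D) := fun w => S (w, ρ x₀) with hs
  have hsc : ContDiffOn ℝ ∞ s O :=
    hS.comp (contDiff_id.prodMk contDiff_const).contDiffOn fun w hw => ⟨hw, trivial⟩
  have hs₀ : s w₀ = x₀ := hS2 w₀ hwO x₀ h.1
  have hc : ContinuousOn (fun w => (s w, gapOp X i (s w) w)) O :=
    hsc.continuousOn.prodMk ((contDiff_gapOp X i).comp_contDiffOn (f := fun w => (s w, w))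
      (hsc.prodMk contDiffOn_id)).continuousOn
  refine ⟨_, s, hc.isOpen_inter_preimage hO (hN.prod isOpen_posForm), ⟨hwO, ?_, ?_⟩,
    hsc.mono Set.inter_subset_left, hs₀, fun w hw => hw.2.1, fun w hw hx => ⟨?_, hw.2.2⟩⟩
  · change s w₀ ∈ N
    rwa [hs₀]
  · change PosForm (gapOp X i (s w₀) w₀)
    rw [hs₀]
    exact h.2
  · exact (hS1 w hw.1 hx _).1

/-- Openness comes from sections through `x` with values in a prescribed neighbourhood: every state
of `M` close to `q x` is attained inside it. -/
theorem isOpenQuotientMap_quantumMap (hX : ∀ a, (X a).IsHermitian) {m : ℕ}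
    (hm : ∀ x ∈ regularDomain X, rankDq X x = m) :
    IsOpenQuotientMap (Set.imageFactorization (quantumMap X) (regularDomain X)) := by
  refine ⟨Set.imageFactorization_surjective, ?_, ?_⟩
  · exact ((contMDiffOn_quantumMap hX).continuousOn.domRestrict).subtype_mk _
  · rw [isOpenMap_iff_nhds_le]
    rintro ⟨x, hx⟩ A hA
    rw [Filter.mem_map, mem_nhds_subtype] at hA
    obtain ⟨N, hN, hNA⟩ := hA
    obtain ⟨i, hi⟩ := exists_mem_affineSource n (quantumMap X x)
    have h := isChartSolution_affineCoord hX hx hi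
    obtain ⟨O, s, hO, hwO, -, -, hsN, hsol⟩ :=
      exists_section hX hm h isOpen_interior (mem_interior_iff_mem_nhds.2 hN)
    rw [mem_nhds_subtype]
    refine ⟨affineSource n i ∩ affineCoord n i ⁻¹' O,
      ((affineChart n i).isOpen_inter_preimage hO).mem_nhds ⟨hi, hwO⟩, ?_⟩
    rintro ⟨_, y, hy, rfl⟩ ⟨hpi, hpO⟩
    have hz := hsol _ hpO ⟨y, isChartSolution_affineCoord hX hy hpi⟩
    have hzA : Set.imageFactorization (quantumMap X) (regularDomain X)
        ⟨_, hz.mem_regularDomain hX⟩ ∈ A :=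
      hNA (show s _ ∈ N from interior_subset (hsN _ hpO))
    have heq : quantumMap X y = quantumMap X (s (affineCoord n i (quantumMap X y))) :=
      ((affineChart n i).left_inv hpi).symm.trans ((isChartSolution_iff hX).1 hz).2.symm
    exact Set.mem_of_eq_of_mem (Subtype.ext heq) hzA

end QuantumMap

section Submanifold

variable {D n : ℕ} {X : Fin D → Matrix (Fin (n + 1)) (Fin (n + 1)) ℂ} {i : Fin (n + 1)}

/-! ### The abstract quantum space is a submanifold -/

theorem mem_abstractQuantumSpace_iff (hX : ∀ a, (X a).IsHermitian) {p : CP n}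
    (hp : p ∈ affineSource n i) :
    p ∈ abstractQuantumSpace X ↔ ∃ x, IsChartSolution X i x (affineCoord n i p) := by
  constructor
  · rintro ⟨x, hx, rfl⟩
    exact ⟨x, isChartSolution_affineCoord hX hx hp⟩
  · rintro ⟨x, hx⟩
    obtain ⟨hx1, hx2⟩ := (isChartSolution_iff hX).1 hx
    exact ⟨x, hx1, hx2.trans ((affineChart n i).left_inv hp)⟩

theorem trans_mem_structureGroupoid_maximalAtlas {H M : Type*} [TopologicalSpace H]
    [TopologicalSpace M] [ChartedSpace H M] {G : StructureGroupoid H}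
    {e : OpenPartialHomeomorph M H} (he : e ∈ G.maximalAtlas M) {φ : OpenPartialHomeomorph H H}
    (hφ : φ ∈ G) : e ≫ₕ φ ∈ G.maximalAtlas M := by
  intro e' he'
  refine ⟨?_, ?_⟩
  · rw [OpenPartialHomeomorph.trans_symm_eq_symm_trans_symm, OpenPartialHomeomorph.trans_assoc]
    exact G.trans (G.symm hφ) (he e' he').1
  · rw [← OpenPartialHomeomorph.trans_assoc]
    exact G.trans (he e' he').2 hφ

theorem trans_mem_maximalAtlas {e : OpenPartialHomeomorph (CP n) (CPModel n)}
    (he : e ∈ IsManifold.maximalAtlas 𝓘(ℝ, CPModel n) ∞ (CP n))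
    {φ : OpenPartialHomeomorph (CPModel n) (CPModel n)}
    (hφ : ContDiffOn ℝ ∞ φ φ.source) (hφ' : ContDiffOn ℝ ∞ φ.symm φ.target) :
    e ≫ₕ φ ∈ IsManifold.maximalAtlas 𝓘(ℝ, CPModel n) ∞ (CP n) := by
  refine trans_mem_structureGroupoid_maximalAtlas he ?_
  rw [contDiffGroupoid, mem_groupoid_of_pregroupoid]
  simpa [contDiffPregroupoid] using And.intro hφ hφ'

theorem isRegularSubmanifold_abstractQuantumSpace (hX : ∀ a, (X a).IsHermitian) {m : ℕ}
    (hm : ∀ x ∈ regularDomain X, rankDq X x = m) :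
    IsRegularSubmanifold m (abstractQuantumSpace X) := by
  rintro _ ⟨x₀, hx₀, rfl⟩
  obtain ⟨i, hi⟩ := exists_mem_affineSource n (quantumMap X x₀)
  have h := isChartSolution_affineCoord hX hx₀ hi
  set w₀ := affineCoord n i (quantumMap X x₀) with hw₀
  obtain ⟨U, g, hU, hxU, hgc, hgx₀, hg, hker⟩ := exists_local_solution hX h
  obtain ⟨O, s, hO, hwO, hsc, hsw₀, hsU, hsol⟩ := exists_section hX hm h hU hxU
  have huniq : ∀ {x w w'}, IsChartSolution X i x w → IsChartSolution X i x w' → w = w' :=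
    fun h h' => (h.affineCoord_eq hX).symm.trans (h'.affineCoord_eq hX)
  set M : Set (CPModel n) := {w | ∃ x, IsChartSolution X i x w}
  -- For any `w ∈ O`, also off `M`, the point `s w` lies in `U`, where `g` yields an actual
  -- quasi-coherent state. So `r` maps into `M`, and it fixes `M ∩ O`.
  set r : CPModel n → CPModel n := fun w => g (s w) with hr
  have hrc : ContDiffOn ℝ ∞ r O := hgc.comp hsc hsU
  have hr₀ : r w₀ = w₀ := by rw [hr]; simp only; rw [hsw₀, hgx₀]
  have hMr : ∀ w ∈ M ∩ O, r w = w := fun w hw =>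
    huniq (hg _ (hsU w hw.2)) (hsol w hw.2 hw.1)
  obtain ⟨φ, hwφ, hφO, hφc, hφc', hφM⟩ := exists_slice_of_retraction (S := M) hO hwO hrc hr₀
    (fun w hw => ⟨s w, hg _ (hsU w hw)⟩) hMr
  refine ⟨affineChart n i ≫ₕ φ, trans_mem_maximalAtlas (affineChart_mem_maximalAtlas i) hφc hφc', ?_,
    LinearMap.range (fderiv ℝ r w₀).toLinearMap, ?_, ?_⟩
  · rw [OpenPartialHomeomorph.trans_source]
    exact ⟨hi, hwφ⟩
  · have hgd : HasFDerivAt g (fderiv ℝ g x₀) x₀ :=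
      ((hgc.contDiffAt (hU.mem_nhds hxU)).differentiableAt (by simp)).hasFDerivAt
    have hrd : HasFDerivAt r (fderiv ℝ r w₀) w₀ :=
      ((hrc.contDiffAt (hO.mem_nhds hwO)).differentiableAt (by simp)).hasFDerivAt
    have hsd : HasFDerivAt s (fderiv ℝ s w₀) w₀ :=
      ((hsc.contDiffAt (hO.mem_nhds hwO)).differentiableAt (by simp)).hasFDerivAt
    have h1 : HasFDerivAt r ((fderiv ℝ g x₀).comp (fderiv ℝ s w₀)) w₀ :=
      HasFDerivAt.comp (g := g) w₀ (by rw [hsw₀]; exact hgd) hsd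
    have h2 : HasFDerivAt g ((fderiv ℝ r w₀).comp (fderiv ℝ g x₀)) x₀ := by
      have h3 : HasFDerivAt (fun x => r (g x)) ((fderiv ℝ r w₀).comp (fderiv ℝ g x₀)) x₀ :=
        HasFDerivAt.comp (g := r) x₀ (by rw [hgx₀]; exact hrd) hgd
      refine h3.congr_of_eventuallyEq ?_
      have hgO : ∀ᶠ x in nhds x₀, g x ∈ O :=
        hgd.continuousAt.eventually_mem (by rw [hgx₀]; exact hO.mem_nhds hwO)
      filter_upwards [hU.mem_nhds hxU, hgO] with x hx hxO
      exact (hMr _ ⟨⟨x, hg x hx⟩, hxO⟩).symm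
    -- The factorizations `r = g ∘ s` near `w₀` and `g = r ∘ g` near `x₀` give the two inclusions.
    have hrange : LinearMap.range (fderiv ℝ r w₀).toLinearMap
        = LinearMap.range (fderiv ℝ g x₀).toLinearMap := by
      apply le_antisymm
      · rintro _ ⟨v, rfl⟩
        exact ⟨fderiv ℝ s w₀ v, (DFunLike.congr_fun (hrd.unique h1) v).symm⟩
      · rintro _ ⟨v, rfl⟩
        exact ⟨fderiv ℝ g x₀ v, (DFunLike.congr_fun (hgd.unique h2) v).symm⟩
    have hk : LinearMap.ker (fderiv ℝ g x₀).toLinearMap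
        = LinearMap.ker (chartLinear X i w₀).toLinearMap := by
      ext v
      exact hker v
    have h4 := h.rankDq_add_finrank_ker hX
    have h5 := LinearMap.finrank_range_add_finrank_ker (fderiv ℝ g x₀).toLinearMap
    rw [hk, finrank_euclideanSpace_fin] at h5
    rw [hm x₀ hx₀] at h4
    rw [hrange]
    omega
  · have htarget : (affineChart n i ≫ₕ φ).target = φ.target := by
      rw [OpenPartialHomeomorph.trans_target]
      exact Set.inter_eq_left.2 fun _ _ => Set.mem_univ _
    rw [htarget, ← hφM]
    ext y
    constructor
    · rintro ⟨p, ⟨hp, hpM⟩, rfl⟩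
      rw [OpenPartialHomeomorph.trans_source] at hp
      exact ⟨affineCoord n i p, ⟨hp.2, (mem_abstractQuantumSpace_iff hX hp.1).1 hpM⟩, rfl⟩
    · rintro ⟨w, ⟨hw, hwM⟩, rfl⟩
      have hpi : (affineChart n i).symm w ∈ affineSource n i :=
        (affineChart n i).map_target (Set.mem_univ w)
      have hpw : affineCoord n i ((affineChart n i).symm w) = w :=
        (affineChart n i).right_inv (Set.mem_univ w)
      refine ⟨(affineChart n i).symm w, ⟨?_, ?_⟩, ?_⟩
      · rw [OpenPartialHomeomorph.trans_source]
        refine ⟨hpi, ?_⟩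
        change affineCoord n i ((affineChart n i).symm w) ∈ φ.source
        rwa [hpw]
      · rw [mem_abstractQuantumSpace_iff hX hpi, hpw]
        exact hwM
      · change φ (affineCoord n i ((affineChart n i).symm w)) = φ w
        rw [hpw]

/-! ### Local triviality -/

theorem contDiffOn_gapOp_comp {E : Type*} [NormedAddCommGroup E] [NormedSpace ℝ E]
    {f : E → EuclideanSpace ℝ (Fin D)} {g : E → CPModel n} {s : Set E}
    (hf : ContDiffOn ℝ ∞ f s) (hg : ContDiffOn ℝ ∞ g s) :
    ContDiffOn ℝ ∞ (fun p => gapOp X i (f p) (g p)) s :=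
  (contDiff_gapOp X i).comp_contDiffOn (f := fun p => (f p, g p)) (hf.prodMk hg)

/-- In the coordinate `y = ρ x - ρ x₀` the fibre over a state `w` of `M` is `{y | Γ (w, y) > 0}`, to
which `exists_fibrewise_diffeo` applies. -/
theorem isLocallyTrivialFibration_quantumMap (hX : ∀ a, (X a).IsHermitian) {m : ℕ}
    (hm : ∀ x ∈ regularDomain X, rankDq X x = m) :
    IsLocallyTrivialFibration (D - m) (regularDomain X) (quantumMap X) := by
  rintro _ ⟨x₀, hx₀, rfl⟩
  obtain ⟨i, hi⟩ := exists_mem_affineSource n (quantumMap X x₀)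
  have h := isChartSolution_affineCoord hX hx₀ hi
  obtain ⟨O, S, ρ, hO, hwO, hS, hSaff, hS1, hS2⟩ := exists_affine_parametrization hX hm h
  set Γ : CPModel n × EuclideanSpace ℝ (Fin (D - m)) → Op n :=
    fun p => gapOp X i (S (p.1, ρ x₀ + p.2)) p.1 with hΓ
  have hSc : ContDiffOn ℝ ∞ (fun p : CPModel n × EuclideanSpace ℝ (Fin (D - m)) =>
      S (p.1, ρ x₀ + p.2)) (O ×ˢ Set.univ) :=
    hS.comp (contDiff_fst.prodMk (contDiff_const.add contDiff_snd)).contDiffOn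
      fun p hp => ⟨hp.1, trivial⟩
  have hΓc : ContDiffOn ℝ ∞ Γ (O ×ˢ Set.univ) :=
    contDiffOn_gapOp_comp hSc contDiffOn_fst
  have hΓ₀ : ContinuousOn (fun w => Γ (w, 0)) O :=
    hΓc.continuousOn.comp (by fun_prop) fun w hw => ⟨hw, trivial⟩
  -- Over `O'` the point `y = 0` stays in the positive region, so it serves as the centre of the
  -- radial maps.
  set O' := O ∩ (fun w => Γ (w, 0)) ⁻¹' {G | PosForm G} with hO'
  have hO'o : IsOpen O' := hΓ₀.isOpen_inter_preimage hO isOpen_posForm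
  have hsub : O' ×ˢ (Set.univ : Set (EuclideanSpace ℝ (Fin (D - m)))) ⊆ O ×ˢ Set.univ :=
    Set.prod_mono Set.inter_subset_left subset_rfl
  have hwO' : affineCoord n i (quantumMap X x₀) ∈ O' := by
    refine ⟨hwO, ?_⟩
    change PosForm (gapOp X i (S (_, ρ x₀ + 0)) _)
    rw [add_zero, hS2 _ hwO x₀ h.1]
    exact h.2
  obtain ⟨η, κ, hη, hκ, hκη, hηκ⟩ := exists_fibrewise_diffeo hO'o (hΓc.mono hsub)
    (fun p => isSymmetric_gapOp hX _ _) (fun w _ y r => by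
      have h1 := hSaff w (ρ x₀) (ρ x₀ + y) r
      rw [add_sub_cancel_left] at h1
      simp only [hΓ, add_zero]
      rw [h1, gapOp_lineMap]) (fun w hw => hw.2)
  have hΓx : ∀ {x w}, w ∈ O → IsChartSolution X i x w → Γ (w, ρ x - ρ x₀) = gapOp X i x w := by
    intro x w hw hx
    simp only [hΓ]
    rw [add_sub_cancel, hS2 _ hw x hx.1]
  refine ⟨affineSource n i ∩ affineCoord n i ⁻¹' O',
    (affineChart n i).isOpen_inter_preimage hO'o, ⟨hi, hwO'⟩,
    fun x => η (affineCoord n i (quantumMap X x), ρ x - ρ x₀),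
    fun p => S (affineCoord n i p.1, ρ x₀ + κ (affineCoord n i p.1, p.2)), ?_, ?_, ?_, ?_⟩
  · refine hη.comp (((contDiffOn_affineCoord_quantumMap hX i).mono ?_).prodMk
      (ρ.contDiff.sub contDiff_const).contDiffOn) ?_
    · exact fun x hx => ⟨hx.1, hx.2.1⟩
    · rintro x ⟨hx, hxi, hxO⟩
      have hsol := isChartSolution_affineCoord hX hx hxi
      refine ⟨hxO, ?_⟩
      rw [hΓx hxO.1 hsol]
      exact hsol.2
  · have h1 : ContDiffOn ℝ ∞ (fun p : CPModel n × EuclideanSpace ℝ (Fin (D - m)) =>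
        S (p.1, ρ x₀ + κ p)) (O' ×ˢ Set.univ) :=
      hS.comp (contDiffOn_fst.prodMk (contDiffOn_const.add hκ)) fun p hp => ⟨hp.1.1, trivial⟩
    have h2 : ContMDiffOn (𝓘(ℝ, CPModel n).prod 𝓘(ℝ, EuclideanSpace ℝ (Fin (D - m))))
        𝓘(ℝ, CPModel n) ∞
        (fun p : CP n × EuclideanSpace ℝ (Fin (D - m)) => affineCoord n i p.1)
        (affineSource n i ×ˢ Set.univ) :=
      (contMDiffOn_of_mem_maximalAtlas (affineChart_mem_maximalAtlas i)).comp contMDiffOn_fst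
        fun p hp => hp.1
    have h3 := h2.prodMk_space (contMDiffOn_snd (I := 𝓘(ℝ, CPModel n)))
    have h4 := h1.contMDiffOn.comp (h3.mono (Set.inter_subset_left (t :=
       {p : CP n × EuclideanSpace ℝ (Fin (D - m)) | affineCoord n i p.1 ∈ O'}))) fun p hp => ⟨hp.2, trivial⟩
    exact h4.mono fun p hp => ⟨⟨hp.1.2.1, trivial⟩, hp.1.2.2⟩
  · rintro x ⟨hx, hxi, hxO⟩
    have hsol := isChartSolution_affineCoord hX hx hxi
    simp only
    rw [hκη _ hxO _ (by rw [hΓx hxO.1 hsol]; exact hsol.2), add_sub_cancel, hS2 _ hxO.1 x hsol.1]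
  · rintro y ⟨hyM, hyi, hyO⟩ t
    have hex := (mem_abstractQuantumSpace_iff hX hyi).1 hyM
    obtain ⟨hp, ht⟩ := hηκ _ hyO t
    obtain ⟨hlin, hρ⟩ := hS1 _ hyO.1 hex (ρ x₀ + κ (affineCoord n i y, t))
    have hsol : IsChartSolution X i
      (S (affineCoord n i y, ρ x₀ + κ (affineCoord n i y, t))) (affineCoord n i y) := ⟨hlin, hp⟩
    refine ⟨hsol.mem_regularDomain hX, ?_, ?_⟩
    · rw [((isChartSolution_iff hX).1 hsol).2]
      exact (affineChart n i).left_inv hyi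
    · simp only
      rw [hsol.affineCoord_eq hX, hρ, add_sub_cancel_left, ht]

end Submanifold

end QuantumSpace
end

theorem mainTheorem2 {D n m : ℕ} (X : Fin D → Matrix (Fin (n + 1)) (Fin (n + 1)) ℂ)
    (hX : ∀ a, (X a).IsHermitian) (hirr : QuantumSpace.IsIrreducible X) :
    -- `R̃^D` is open and `q` is smooth on it
    (IsOpen (QuantumSpace.regularDomain X) ∧
      ContMDiffOn 𝓘(ℝ, EuclideanSpace ℝ (Fin D)) 𝓘(ℝ, QuantumSpace.CPModel n) ∞
        (QuantumSpace.quantumMap X) (QuantumSpace.regularDomain X)) ∧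
    -- if `dq` has constant rank `m`, then:
    ((∀ x ∈ QuantumSpace.regularDomain X, QuantumSpace.rankDq X x = m) →
    -- each `N_x` is a convex, relatively open subset of an affine subspace of dimension `D - m`
    (∀ x ∈ QuantumSpace.regularDomain X,
      Convex ℝ (QuantumSpace.equivClass X x) ∧
      ∃ (L : AffineSubspace ℝ (EuclideanSpace ℝ (Fin D))) (U : Set (EuclideanSpace ℝ (Fin D))),
        Module.finrank ℝ L.direction + m = D ∧ IsOpen U ∧
          QuantumSpace.equivClass X x = (L : Set (EuclideanSpace ℝ (Fin D))) ∩ U) ∧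
    -- `q : R̃^D → M` is a locally trivial fibration
    QuantumSpace.IsLocallyTrivialFibration (D - m) (QuantumSpace.regularDomain X)
      (QuantumSpace.quantumMap X) ∧
    -- `M` is a regular submanifold of `ℂP^n` of dimension `m`
    QuantumSpace.IsRegularSubmanifold m (QuantumSpace.abstractQuantumSpace X) ∧
    -- no self-intersections: `M`, with the subspace topology, is the quotient `R̃^D / ∼`, and open
    -- sets of `R̃^D` have images that are open in `M`
    (∀ x ∈ QuantumSpace.regularDomain X, ∀ y ∈ QuantumSpace.regularDomain X,
      QuantumSpace.quantumMap X x = QuantumSpace.quantumMap X y ↔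
        y ∈ QuantumSpace.equivClass X x) ∧
    IsOpenQuotientMap (Set.imageFactorization (QuantumSpace.quantumMap X)
      (QuantumSpace.regularDomain X))) := by
  refine ⟨⟨QuantumSpace.isOpen_regularDomain hX, QuantumSpace.contMDiffOn_quantumMap hX⟩,
    fun hm => ⟨fun x hx => ?_, QuantumSpace.isLocallyTrivialFibration_quantumMap hX hm,
      QuantumSpace.isRegularSubmanifold_abstractQuantumSpace hX hm,
      fun x hx y hy => QuantumSpace.quantumMap_eq_iff_mem_equivClass hx hy,
      QuantumSpace.isOpenQuotientMap_quantumMap hX hm⟩⟩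
  have h := QuantumSpace.equivClass_convex_and_affine hX hx
  rwa [hm x hx] at h
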